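/- Let $dm(t)=\frac{t}{e^t-1}\,dt$ on $(0,\infty)$, and let $M$ be the multiplication operator $(M\varphi)(t)=e^{-t}\varphi(t)$ on $L_2(m)$. For $q\in\{0,1,2,\dots\}$ put $$(\mathcal L_q\varphi)(w)=\int_0^\infty e^{-tw}\,t^q\,\varphi(t)\,dm(t),\qquad \varphi\in L_2(m),\ \Re w>-\tfrac12 ,$$ and let $\mathcal H_{1,q}=\mathcal L_q[L_2(m)]$. The map $\mathcal L_q$ is injective, and $\mathcal H_{1,q}$ is the Hilbert space with inner product $(\mathcal L_q\varphi_1,\mathcal L_q\varphi_2)=\int_0^\infty\overline{\varphi_1}\,\varphi_2\,dm$. With $\Phi_n(x)=\frac1{x+n}$ and $\tau(x)=[1/x]$, let $$(\mathcal Q_{z,q}f)(x)=(-1)^q\sum_{n\ge1}z^{\tau(\Phi_n(x))}\,|\Phi_n'(x)|^{1+q}\,f(\Phi_n(x)),\qquad 0<x<1,$$ extended holomorphically to $\Re w>-\frac12$ as $(-1)^q\sum_{n\ge1}z^n(w+n)^{-2(1+q)}f\big(\frac1{w+n}\big)$. Let $J_p$ be the Bessel function of the first kind of order $p$. **Proposition.**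 Let $q\in\{0,1,2,\dots\}$. 1. The formula $(\mathcal B_q\varphi)(t)=\int_0^\infty \frac{J_{2q+1}(2\sqrt{st})}{\sqrt{st}}\,\varphi(s)\,dm(s)$ (with absolutely convergent integral) defines a bounded operator on $L_2(m)$. For $z\in\mathbb C\setminus(1,\infty)$ the operator $$\mathcal K_{z,q}=(-1)^q\,z\,(1-M)(1-zM)^{-1}\mathcal B_q$$ is a bounded operator on $L_2(m)$, where $(1-M)(1-zM)^{-1}$ is multiplication by $\frac{1-e^{-t}}{1-ze^{-t}}$ (the identity if $z=1$), and $1-zM$ has a bounded inverse if $z\neq1$. 2. For $|z|\le1$ and $f\in\mathcal H_{1,q}$ the series for $\mathcal Q_{z,q}f$ converges absolutely at every point and its sum lies in $\mathcal H_{1,q}$; this defines a bounded operator $\mathcal Q_{z,q}$ on $\mathcal H_{1,q}$. The function $z\mapsto\mathcal Q_{z,q}$ has an extension to bounded operators on $\mathcal H_{1,q}$ for all $z\in\mathbb C\setminus(1,\infty)$, which is analytic in the operator norm on the interior $\mathbb C\setminus[1,\infty)$ of this set and continuous in the operator norm on each sector $\{z:|\arg(1-z)|\le\theta\}$, $\theta<\pi$,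 with the vertex $z=1$ included. 3. For every $z\in\mathbb C\setminus(1,\infty)$ and $\varphi\in L_2(m)$, $$\mathcal Q_{z,q}\,\mathcal L_q[\varphi]=\mathcal L_q[\mathcal K_{z,q}\varphi],$$ and $\mathcal Q_{z,q}:\mathcal H_{1,q}\to\mathcal H_{1,q}$ and $\mathcal K_{z,q}:L_2(m)\to L_2(m)$ are both of trace class, that is, of the form $\sum_n(a_n,\cdot)\,b_n$ with $\sum_n\|a_n\|\,\|b_n\|<\infty$. -/

import Mathlib

open MeasureTheory Set Filter Topology
open scoped ENNReal ContDiff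

noncomputable section

namespace FareyGauss

/-- The measure `dm(t) = t / (e^t - 1) dt` on `(0, ∞)`. -/
def mMeas : Measure ℝ :=
  (volume.restrict (Ioi 0)).withDensity (fun t => ENNReal.ofReal (t / (Real.exp t - 1)))

/-- The Hilbert space `L₂(m)`. -/
abbrev L2m : Type := Lp ℂ 2 mMeas

lemma ae_mMeas_pos : ∀ᵐ t ∂mMeas, 0 < t :=
  (withDensity_absolutelyContinuous _ _).ae_le (ae_restrict_mem measurableSet_Ioi)

lemma density_le {t : ℝ} (ht : 0 < t) : t / (Real.exp t - 1) ≤ (1 + t) * Real.exp (-t) := by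
  have h1 : 0 < Real.exp t - 1 := by
    have := Real.add_one_lt_exp ht.ne'
    linarith
  rw [div_le_iff₀ h1]
  have h2 : Real.exp (-t) * Real.exp t = 1 := by rw [← Real.exp_add]; simp
  have h3 : (1 + t) * Real.exp (-t) ≤ 1 := by
    have := Real.add_one_le_exp t
    have h4 := Real.exp_pos (-t)
    nlinarith
  nlinarith

lemma integrable_pow_mul_exp (k : ℕ) {c : ℝ} (hc : c < 1) :
    Integrable (fun t : ℝ => t ^ k * Real.exp (c * t)) mMeas := by
  have hm : Measurable (fun t : ℝ => ENNReal.ofReal (t / (Real.exp t - 1))) := by fun_prop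
  rw [mMeas, integrable_withDensity_iff_integrable_smul' hm (by simp)]
  have hp : ∀ j : ℕ, IntegrableOn (fun t : ℝ => t ^ j * Real.exp (-((1 - c) * t))) (Ioi 0) := by
    intro j
    have h := integrableOn_rpow_mul_exp_neg_mul_rpow (s := j) (p := 1) (b := 1 - c)
      (by have : (0 : ℝ) ≤ j := Nat.cast_nonneg j
          linarith) one_pos (by linarith)
    refine h.congr_fun (fun t _ => ?_) measurableSet_Ioi
    simp only [Real.rpow_natCast, Real.rpow_one]
    rw [neg_mul]
  have hs : IntegrableOn (fun t : ℝ => t ^ k * Real.exp (-((1 - c) * t)) +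
      t ^ (k + 1) * Real.exp (-((1 - c) * t))) (Ioi 0) := (hp k).add (hp (k + 1))
  refine Integrable.mono' hs (by fun_prop) ?_
  filter_upwards [ae_restrict_mem measurableSet_Ioi] with t ht
  have ht : 0 < t := ht
  have h1 : 0 < Real.exp t - 1 := by
    have := Real.add_one_lt_exp ht.ne'
    linarith
  have h0 : 0 ≤ t / (Real.exp t - 1) := by positivity
  rw [ENNReal.toReal_ofReal h0, smul_eq_mul, Real.norm_of_nonneg (by positivity)]
  calc t / (Real.exp t - 1) * (t ^ k * Real.exp (c * t))
      ≤ ((1 + t) * Real.exp (-t)) * (t ^ k * Real.exp (c * t)) := by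
        gcongr
        exact density_le ht
    _ = (1 + t) * t ^ k * (Real.exp (-t) * Real.exp (c * t)) := by ring
    _ = _ := by
        rw [← Real.exp_add, show -t + c * t = -((1 - c) * t) by ring]
        ring

instance : IsFiniteMeasure mMeas := by
  have h := integrable_pow_mul_exp 0 (c := 0) (by norm_num)
  simp only [pow_zero, zero_mul, Real.exp_zero, mul_one] at h
  exact ((integrable_const_iff).1 h).resolve_left (by norm_num)

/-- The half plane `Re w > -1/2`. -/
abbrev HalfPlane : Type := {w : ℂ // -(1 / 2 : ℝ) < w.re}

lemma memLp_kernel (q : ℕ) (w : HalfPlane) :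
    MemLp (fun t : ℝ => Complex.exp (-(t * (w : ℂ))) * (t : ℂ) ^ q) 2 mMeas := by
  rw [memLp_two_iff_integrable_sq_norm (by fun_prop)]
  have h := integrable_pow_mul_exp (2 * q) (c := -2 * (w : ℂ).re) (by have := w.2; linarith)
  refine h.congr (.of_forall fun t => ?_)
  simp only [norm_mul, Complex.norm_exp, norm_pow, Complex.norm_real, mul_pow]
  rw [← Real.exp_nat_mul, ← pow_mul, mul_comm q 2, pow_mul, pow_mul, Real.norm_eq_abs, sq_abs,
    mul_comm]
  congr 2
  simp
  ring

lemma integrable_kernel (q : ℕ) (w : HalfPlane) (φ : L2m) :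
    Integrable (fun t : ℝ => Complex.exp (-(t * (w : ℂ))) * (t : ℂ) ^ q * φ t) mMeas :=
  (memLp_kernel q w).integrable_mul (Lp.memLp φ)

/-- The generalized Laplace transform `(L_q φ)(w) = ∫ e^{-tw} t^q φ(t) dm(t)`, `Re w > -1/2`. -/
def laplace (q : ℕ) : L2m →ₗ[ℂ] (HalfPlane → ℂ) where
  toFun φ w := ∫ t : ℝ, Complex.exp (-(t * (w : ℂ))) * (t : ℂ) ^ q * φ t ∂mMeas
  map_add' φ ψ := by
    funext w
    rw [Pi.add_apply, ← integral_add (integrable_kernel q w φ) (integrable_kernel q w ψ)]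
    refine integral_congr_ae ?_
    filter_upwards [Lp.coeFn_add φ ψ] with t ht
    rw [ht, Pi.add_apply]
    ring
  map_smul' c φ := by
    funext w
    rw [Pi.smul_apply, RingHom.id_apply, smul_eq_mul, ← integral_const_mul]
    refine integral_congr_ae ?_
    filter_upwards [Lp.coeFn_smul c φ] with t ht
    rw [ht, Pi.smul_apply, smul_eq_mul]
    ring

lemma laplace_injective (q : ℕ) : Function.Injective (laplace q) := by
  rw [injective_iff_map_eq_zero]
  intro φ hφ
  have hint : Integrable (fun t : ℝ => (t : ℂ) ^ q * φ t) mMeas := by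
    simpa using integrable_kernel q ⟨0, by norm_num⟩ φ
  have hz : ∀ ξ : ℝ, VectorFourier.fourierIntegral Real.fourierChar mMeas (innerₗ ℝ)
      (fun t : ℝ => (t : ℂ) ^ q * φ t) ξ = 0 := by
    intro ξ
    have := congrFun hφ ⟨2 * Real.pi * ξ * Complex.I, by simp⟩
    rw [← show _ = (0 : ℂ) from this]
    simp only [laplace, LinearMap.coe_mk, AddHom.coe_mk, VectorFourier.fourierIntegral]
    congr 1
    funext t
    rw [Circle.smul_def, Real.fourierChar_apply, smul_eq_mul, ← mul_assoc]
    congr 3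
    simp
    ring
  have hae : ∀ᵐ t : ℝ ∂mMeas, (t : ℂ) ^ q * φ t = 0 := by
    refine ae_eq_zero_of_integral_contDiff_smul_eq_zero hint.locallyIntegrable ?_
    intro g hg hgs
    let G : SchwartzMap ℝ ℂ := HasCompactSupport.toSchwartzMap (f := fun x => (g x : ℂ))
      (hgs.comp_left (g := fun x : ℝ => (x : ℂ)) rfl)
      (Complex.ofRealCLM.contDiff.comp hg)
    have hGg : ∀ x, G x = (g x : ℂ) := fun _ => rfl
    let F : SchwartzMap ℝ ℂ := FourierTransformInv.fourierInv G
    have h := VectorFourier.integral_fourierIntegral_smul_eq_flip (μ := mMeas)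
      (ν := (volume : Measure ℝ)) (L := innerₗ ℝ)
      (f := fun t : ℝ => (t : ℂ) ^ q * φ t) (g := (F : ℝ → ℂ)) Real.continuous_fourierChar
      (by simp only [innerₗ_apply_apply]; exact continuous_inner) hint F.integrable
    simp only [hz, zero_smul, integral_zero] at h
    rw [h]
    refine integral_congr_ae (.of_forall fun t => ?_)
    have h2 : VectorFourier.fourierIntegral Real.fourierChar volume (innerₗ ℝ).flip
        (F : ℝ → ℂ) t = G t := by
      rw [flip_innerₗ]
      have : FourierTransform.fourier F = G := FourierTransform.fourier_fourierInv_eq G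
      rw [← this]
      rfl
    simp only [h2, hGg, smul_eq_mul, Complex.real_smul]
    ring
  rw [Lp.eq_zero_iff_ae_eq_zero]
  filter_upwards [hae, ae_mMeas_pos] with t ht h0
  have : (t : ℂ) ≠ 0 := by exact_mod_cast h0.ne'
  simpa [this] using ht

/-- The space `H_{1,q}` of all functions on `Re w > -1/2` of the form `L_q φ`, `φ ∈ L₂(m)`. -/
def H1 (q : ℕ) : Type := ↥(LinearMap.range (laplace q))

namespace H1

variable {q : ℕ}

instance : AddCommGroup (H1 q) := inferInstanceAs (AddCommGroup ↥(LinearMap.range (laplace q)))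

instance : Module ℂ (H1 q) := inferInstanceAs (Module ℂ ↥(LinearMap.range (laplace q)))

instance : CoeFun (H1 q) (fun _ => HalfPlane → ℂ) := ⟨fun f => f.1⟩

end H1

/-- `L_q` as a bijection from `L₂(m)` onto `H_{1,q}`. -/
def laplaceEquivₗ (q : ℕ) : L2m ≃ₗ[ℂ] H1 q :=
  LinearEquiv.ofInjective (laplace q) (laplace_injective q)

namespace H1

variable {q : ℕ}

instance : NormedAddCommGroup (H1 q) :=
  NormedAddCommGroup.induced (H1 q) L2m (laplaceEquivₗ q).symm.toLinearMap
    (laplaceEquivₗ q).symm.injective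

instance : NormedSpace ℂ (H1 q) :=
  NormedSpace.induced ℂ (H1 q) L2m (laplaceEquivₗ q).symm.toLinearMap

/-- The inner product `(L_q φ₁, L_q φ₂) = ∫ conj φ₁ φ₂ dm`. -/
instance : InnerProductSpace ℂ (H1 q) where
  inner f g := inner ℂ ((laplaceEquivₗ q).symm f) ((laplaceEquivₗ q).symm g)
  norm_sq_eq_re_inner f := norm_sq_eq_re_inner (𝕜 := ℂ) ((laplaceEquivₗ q).symm f)
  conj_inner_symm f g := inner_conj_symm (𝕜 := ℂ) _ _
  add_left f g h := by rw [map_add, inner_add_left]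
  smul_left f g c := by rw [map_smul, inner_smul_left]

end H1

/-- `L_q` as a unitary map from `L₂(m)` onto `H_{1,q}`. -/
def laplaceEquiv (q : ℕ) : L2m ≃ₗᵢ[ℂ] H1 q :=
  { laplaceEquivₗ q with
    norm_map' := fun φ => by
      change ‖(laplaceEquivₗ q).symm (laplaceEquivₗ q φ)‖ = ‖φ‖
      rw [LinearEquiv.symm_apply_apply] }

lemma laplaceEquiv_apply (q : ℕ) (φ : L2m) (w : HalfPlane) :
    laplaceEquiv q φ w =
      ∫ t : ℝ, Complex.exp (-(t * (w : ℂ))) * (t : ℂ) ^ q * φ t ∂mMeas := rfl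

instance (q : ℕ) : CompleteSpace (H1 q) :=
  (laplaceEquiv q).symm.toIsometryEquiv.completeSpace

/-- The inverse branches `Φ_n(x) = 1 / (x + n)` of the Gauss map on the unit interval. -/
def branch (n : ℕ) (x : ℝ) : ℝ := 1 / (x + n)

/-- The first passage time `τ(x) = [1 / x]`. -/
def passageTime (x : ℝ) : ℕ := ⌊1 / x⌋₊

/-- The branches `Φ_{n+1}(w) = 1 / (w + n + 1)` on the half plane. -/
def branchC (n : ℕ) (w : HalfPlane) : HalfPlane :=
  ⟨1 / ((w : ℂ) + (n + 1 : ℕ)), by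
    have h : 0 < ((w : ℂ) + (n + 1 : ℕ)).re := by
      have := w.2
      have h0 : (0 : ℝ) ≤ n := Nat.cast_nonneg n
      simp
      linarith
    have h2 : 0 ≤ (1 / ((w : ℂ) + (n + 1 : ℕ))).re := by
      rw [one_div, Complex.inv_re]
      exact div_nonneg h.le (Complex.normSq_nonneg _)
    linarith⟩

/-- A point of the unit interval, as a point of the half plane. -/
def ofUnit (x : ℝ) (hx : x ∈ Ioo (0 : ℝ) 1) : HalfPlane :=
  ⟨x, by rw [Complex.ofReal_re]; linarith [hx.1]⟩

lemma branch_mem (n : ℕ) {x : ℝ} (hx : x ∈ Ioo (0 : ℝ) 1) :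
    branch (n + 1) x ∈ Ioo (0 : ℝ) 1 := by
  have h0 : (0 : ℝ) ≤ n := Nat.cast_nonneg n
  have h1 := hx.1
  have h : 1 < x + (n + 1 : ℕ) := by push_cast; linarith
  exact ⟨by unfold branch; positivity, by
    unfold branch
    rw [div_lt_one (by linarith)]
    exact h⟩

/-- `g = Q_{z,q} f`, with an absolutely convergent series: on the unit interval
`g(x) = (-1)^q ∑_{n ≥ 1} z^{τ(Φ_n(x))} |Φ_n'(x)|^{1+q} f(Φ_n(x))`, and on the whole half plane `g`
is given by the holomorphic extension of this series, in which `z^{τ(Φ_n(x))} = z^n` and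
`|Φ_n'(x)|` is continued as `(w + n)^{-2}`. -/
def IsTransfer (q : ℕ) (z : ℂ) (f g : HalfPlane → ℂ) : Prop :=
  (∀ (x : ℝ) (hx : x ∈ Ioo (0 : ℝ) 1),
    HasSum (fun n : ℕ => (-1 : ℂ) ^ q * (z ^ passageTime (branch (n + 1) x) *
      ((|deriv (branch (n + 1)) x| ^ (1 + q) : ℝ) : ℂ) *
        f (ofUnit (branch (n + 1) x) (branch_mem n hx)))) (g (ofUnit x hx))) ∧
  ∀ w : HalfPlane,
    HasSum (fun n : ℕ => (-1 : ℂ) ^ q * (z ^ (n + 1) *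
      (1 / ((w : ℂ) + (n + 1 : ℕ)) ^ 2) ^ (1 + q) * f (branchC n w))) (g w)

/-- The Bessel function of the first kind of integer order `p ≥ 0`, on the real line. -/
def besselJ (p : ℕ) (x : ℝ) : ℝ :=
  ∑' k : ℕ, (-1 : ℝ) ^ k / ((k.factorial : ℝ) * ((k + p).factorial : ℝ)) * (x / 2) ^ (2 * k + p)

/-- The kernel `J_{2q+1}(2 √(st)) / √(st)`. -/
def besselKernel (q : ℕ) (s t : ℝ) : ℝ :=
  besselJ (2 * q + 1) (2 * √(s * t)) / √(s * t)

/-- The function `e^{-t}` as an element of `L_∞(m)`. -/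
def expNegLp : Lp ℂ ∞ mMeas :=
  MemLp.toLp (fun t : ℝ => Complex.exp (-(t : ℂ))) <| by
    refine memLp_top_of_bound (by fun_prop) 1 ?_
    filter_upwards [ae_mMeas_pos] with t ht
    rw [Complex.norm_exp]
    simpa using ht.le

/-- The multiplication operator `(M φ)(t) = e^{-t} φ(t)` on `L₂(m)`. -/
def mulM : L2m →L[ℂ] L2m :=
  (ContinuousLinearMap.mul ℂ ℂ).holderL mMeas ∞ 2 2 expNegLp

lemma mulM_apply (φ : L2m) : ∀ᵐ t ∂mMeas, mulM φ t = Complex.exp (-(t : ℂ)) * φ t := by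
  have h1 := (ContinuousLinearMap.mul ℂ ℂ).coeFn_holder (r := 2) expNegLp φ
  have h2 : (expNegLp : ℝ → ℂ) =ᵐ[mMeas] fun t : ℝ => Complex.exp (-(t : ℂ)) :=
    MemLp.coeFn_toLp _
  filter_upwards [h1, h2] with t ht1 ht2
  change (ContinuousLinearMap.mul ℂ ℂ).holder 2 expNegLp φ t = _
  rw [ht1, ht2]
  rfl

/-- Trace class (nuclear) operators on a Hilbert space: `T = ∑ ⟨aₙ, ·⟩ bₙ` with
`∑ ‖aₙ‖ ‖bₙ‖ < ∞`. -/
def IsTraceClass {H : Type*} [NormedAddCommGroup H] [InnerProductSpace ℂ H]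
    (T : H →L[ℂ] H) : Prop :=
  ∃ a b : ℕ → H, Summable (fun n => ‖a n‖ * ‖b n‖) ∧
    ∀ x : H, HasSum (fun n => inner ℂ (a n) x • b n) (T x)

/-- The plane cut along the open ray `(1, ∞)`. -/
def cutPlane : Set ℂ := {z | ¬ (1 < z.re ∧ z.im = 0)}

/-- The interior of `cutPlane`: the plane cut along the closed ray `[1, ∞)`. -/
def openCutPlane : Set ℂ := {z | ¬ (1 ≤ z.re ∧ z.im = 0)}

end FareyGauss

end

/-!
The Bessel kernel `J_{2q+1}(2√(st)) / √(st)` has an expansion in products of Laguerre functions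
of `s` and of `t` that is absolutely summable in `L₂(m)`, so `B_q` is nuclear, and it is
self-adjoint because the kernel is real and symmetric. Moving `B_q` onto the explicit functions
`(e^t - 1) e^{-tu} t^q`, whose images are elementary Laplace transforms, gives
`∫ (e^t - 1) e^{-tu} t^q (B_q φ)(t) dm(t) = u^{-2(1+q)} (L_q φ)(1/u)`. With `u = w + n` this is a
single branch of the transfer operator, and the geometric series
`z (1 - e^{-t}) / (1 - z e^{-t}) = ∑ zⁿ e^{-nt} (e^t - 1)` sums up the branches for `|z| ≤ 1`; the
left-hand side makes sense on the whole cut plane and supplies the continuation.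

Since `1 - z e^{-t} = (1 - e^{-t}) + e^{-t} (1 - z)`, the multiplier is bounded by `1 / cos(θ/2)`
for `|arg(1 - z)| ≤ θ`. Hence the multiplication operators are strongly continuous up to `z = 1`,
and composition with the nuclear `B_q` turns this into continuity in norm.
-/

noncomputable section

namespace FareyGauss

namespace IsTraceClass

variable {H H' F : Type*} [NormedAddCommGroup H] [InnerProductSpace ℂ H]
  [NormedAddCommGroup H'] [InnerProductSpace ℂ H'] [NormedAddCommGroup F] [NormedSpace ℂ F]
  {B : H →L[ℂ] H}

lemma mul_left (hB : IsTraceClass B) (T : H →L[ℂ] H) : IsTraceClass (T * B) := by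
  obtain ⟨a, b, hsum, hB⟩ := hB
  refine ⟨a, fun n => T (b n), ?_, fun x => by simpa using (hB x).mapL T⟩
  refine (hsum.mul_left ‖T‖).of_nonneg_of_le (fun n => by positivity) fun n => ?_
  calc ‖a n‖ * ‖T (b n)‖ ≤ ‖a n‖ * (‖T‖ * ‖b n‖) := by gcongr; exact T.le_opNorm _
    _ = ‖T‖ * (‖a n‖ * ‖b n‖) := by ring

lemma smul (hB : IsTraceClass B) (c : ℂ) : IsTraceClass (c • B) := by
  simpa using hB.mul_left (c • 1)

lemma conj (hB : IsTraceClass B) (e : H ≃ₗᵢ[ℂ] H') :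
    IsTraceClass ((e : H →L[ℂ] H') ∘L B ∘L (e.symm : H' →L[ℂ] H)) := by
  obtain ⟨a, b, hsum, hB⟩ := hB
  refine ⟨fun n => e (a n), fun n => e (b n), by simpa using hsum, fun x => ?_⟩
  simpa [e.inner_map_eq_flip] using (hB (e.symm x)).mapL (e : H →L[ℂ] H')

lemma norm_comp_le_tsum {a b : ℕ → H} (hsum : Summable fun n => ‖a n‖ * ‖b n‖)
    (hB : ∀ x, HasSum (fun n => inner ℂ (a n) x • b n) (B x)) (T : H →L[ℂ] F) :
    ‖T ∘L B‖ ≤ ∑' n, ‖a n‖ * ‖T (b n)‖ := by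
  have hsumT : Summable fun n => ‖a n‖ * ‖T (b n)‖ := by
    refine (hsum.mul_left ‖T‖).of_nonneg_of_le (fun n => by positivity) fun n => ?_
    rw [mul_left_comm]
    gcongr
    exact T.le_opNorm _
  refine ContinuousLinearMap.opNorm_le_bound _ (tsum_nonneg fun n => by positivity) fun x => ?_
  have hTB : HasSum (fun n => inner ℂ (a n) x • T (b n)) ((T ∘L B) x) := by
    simpa using (hB x).mapL T
  rw [← hTB.tsum_eq]
  refine tsum_of_norm_bounded (hsumT.hasSum.mul_right ‖x‖) fun n => ?_
  calc ‖inner ℂ (a n) x • T (b n)‖ ≤ ‖a n‖ * ‖x‖ * ‖T (b n)‖ := by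
        rw [norm_smul]
        gcongr
        exact norm_inner_le_norm _ _
    _ = ‖a n‖ * ‖T (b n)‖ * ‖x‖ := by ring

lemma tendsto_comp {ι : Type*} {l : Filter ι} (hB : IsTraceClass B) {T : ι → H →L[ℂ] F}
    {T₀ : H →L[ℂ] F} {C : ℝ} (hC : ∀ᶠ i in l, ‖T i‖ ≤ C)
    (hT : ∀ x, Tendsto (fun i => T i x) l (𝓝 (T₀ x))) :
    Tendsto (fun i => T i ∘L B) l (𝓝 (T₀ ∘L B)) := by
  obtain ⟨a, b, hsum, hB⟩ := hB
  have hlim : Tendsto (fun i => ∑' n, ‖a n‖ * ‖(T i - T₀) (b n)‖) l (𝓝 0) := by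
    rw [← tsum_zero (α := ℝ) (β := ℕ)]
    refine tendsto_tsum_of_dominated_convergence (hsum.mul_left (C + ‖T₀‖)) (fun n => ?_) ?_
    · simpa using (((hT (b n)).sub_const (T₀ (b n))).norm.const_mul ‖a n‖)
    · filter_upwards [hC] with i hi n
      rw [Real.norm_of_nonneg (by positivity), mul_left_comm]
      gcongr
      refine (T i - T₀).le_of_opNorm_le ((norm_sub_le _ _).trans ?_) _
      gcongr
  rw [tendsto_iff_norm_sub_tendsto_zero]
  refine squeeze_zero (fun _ => norm_nonneg _) (fun i => ?_) hlim
  rw [← ContinuousLinearMap.sub_comp]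
  exact norm_comp_le_tsum hsum hB (T i - T₀)

end IsTraceClass

section Nuclear

variable {H : Type*} [NormedAddCommGroup H] [InnerProductSpace ℂ H]

/-- The nuclear operator `∑ ⟨aₙ, ·⟩ bₙ`. The series is only meaningful when `∑ ‖aₙ‖ ‖bₙ‖ < ∞`, and
the value is `0` when it diverges in operator norm. -/
def nuclear (a b : ℕ → H) : H →L[ℂ] H :=
  ∑' n, InnerProductSpace.rankOne ℂ (b n) (a n)

variable [CompleteSpace H] {a b : ℕ → H}

lemma hasSum_nuclear (hab : Summable fun n => ‖a n‖ * ‖b n‖) (x : H) :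
    HasSum (fun n => inner ℂ (a n) x • b n) (nuclear a b x) := by
  have hsum : Summable fun n => InnerProductSpace.rankOne ℂ (b n) (a n) :=
    .of_norm (by simpa [mul_comm] using hab)
  simpa [nuclear] using hsum.hasSum.mapL (ContinuousLinearMap.apply ℂ H x)

lemma isTraceClass_nuclear (hab : Summable fun n => ‖a n‖ * ‖b n‖) :
    IsTraceClass (nuclear a b) :=
  ⟨a, b, hab, hasSum_nuclear hab⟩

lemma adjoint_nuclear (hab : Summable fun n => ‖a n‖ * ‖b n‖) :
    ContinuousLinearMap.adjoint (nuclear a b) = nuclear b a := by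
  symm
  rw [ContinuousLinearMap.eq_adjoint_iff]
  intro x y
  have hba : Summable fun n => ‖b n‖ * ‖a n‖ := by simpa only [mul_comm] using hab
  have hleft := ((hasSum_nuclear hba x).mapL (innerSL ℂ y)).star
  have hright := (hasSum_nuclear hab y).mapL (innerSL ℂ x)
  simp only [innerSL_apply_apply, inner_smul_right, star_mul', RCLike.star_def,
    inner_conj_symm] at hleft hright
  exact hleft.unique (hright.congr_fun fun n => mul_comm _ _)

end Nuclear

section NuclearKernel

variable {α : Type*} [MeasurableSpace α] {μ : Measure α}

lemma integrable_of_hasSum {f : ℕ → α → ℂ} {g : α → ℂ} (hf : ∀ n, Integrable (f n) μ)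
    (hsum : Summable fun n => ∫ s, ‖f n s‖ ∂μ) (hg : ∀ᵐ s ∂μ, HasSum (fun n => f n s) (g s)) :
    Integrable g μ := by
  let F : ℕ → Lp ℂ 1 μ := fun n => (hf n).toL1 (f n)
  have hF : Summable fun n => ‖F n‖ := by
    simpa [F, L1.norm_of_fun_eq_integral_norm] using hsum
  refine (L1.integrable_coeFn (∑' n, F n)).congr ?_
  filter_upwards [Lp.hasSum_coeFn_tsum (tsum_enorm_ne_top_iff_summable_norm.2 hF), hg,
    ae_all_iff.2 fun n => (hf n).coeFn_toL1] with s hs hgs hfs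
  exact (hs.congr_fun fun n => (hfs n).symm).unique hgs

lemma hasSum_integral_of_hasSum {f : ℕ → α → ℂ} {g : α → ℂ} (hf : ∀ n, Integrable (f n) μ)
    (hsum : Summable fun n => ∫ s, ‖f n s‖ ∂μ) (hg : ∀ᵐ s ∂μ, HasSum (fun n => f n s) (g s)) :
    HasSum (fun n => ∫ s, f n s ∂μ) (∫ s, g s ∂μ) := by
  have hgf : g =ᵐ[μ] fun s => ∑' n, f n s := hg.mono fun s hs => hs.tsum_eq.symm
  rw [integral_congr_ae hgf]
  exact hasSum_integral_of_summable_integral_norm hf hsum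

lemma integral_norm_inner_le (f g : Lp ℂ 2 μ) :
    ∫ s, ‖inner ℂ (f s) (g s)‖ ∂μ ≤ ‖f‖ * ‖g‖ := by
  let F : Lp ℝ 2 μ := (Lp.memLp f).norm.toLp
  let G : Lp ℝ 2 μ := (Lp.memLp g).norm.toLp
  have hF : ‖F‖ = ‖f‖ := by rw [Lp.norm_toLp, eLpNorm_norm, Lp.norm_def]
  have hG : ‖G‖ = ‖g‖ := by rw [Lp.norm_toLp, eLpNorm_norm, Lp.norm_def]
  calc ∫ s, ‖inner ℂ (f s) (g s)‖ ∂μ = inner ℝ F G := by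
        rw [L2.inner_def]
        refine integral_congr_ae ?_
        filter_upwards [(Lp.memLp f).norm.coeFn_toLp, (Lp.memLp g).norm.coeFn_toLp] with s hf hg
        simp [F, G, hf, hg, mul_comm]
    _ ≤ ‖f‖ * ‖g‖ := hF ▸ hG ▸ real_inner_le_norm F G

lemma nuclear_ae_eq_integral {a b : ℕ → Lp ℂ 2 μ} (hab : Summable fun n => ‖a n‖ * ‖b n‖)
    {k : α → α → ℂ} {S : Set α} (hS : ∀ᵐ t ∂μ, t ∈ S)
    (hk : ∀ s ∈ S, ∀ t ∈ S, HasSum (fun n => starRingEnd ℂ (a n s) * b n t) (k s t))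
    (φ : Lp ℂ 2 μ) :
    ∀ᵐ t ∂μ, Integrable (fun s => k s t * φ s) μ ∧
      nuclear a b φ t = ∫ s, k s t * φ s ∂μ := by
  have hcoef : Summable fun n => ‖(‖a n‖ : ℂ) • b n‖ :=
    hab.congr fun n => by rw [norm_smul, Complex.norm_real, norm_norm]
  have hval : Summable fun n => ‖inner ℂ (a n) φ • b n‖ := by
    refine (hab.mul_right ‖φ‖).of_nonneg_of_le (fun n => norm_nonneg _) fun n => ?_
    rw [norm_smul, mul_right_comm]
    gcongr
    exact norm_inner_le_norm _ _
  filter_upwards [hS,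
    summable_norm_of_tsum_eLpNorm_ne_top one_le_two
      (fun n => Lp.aestronglyMeasurable ((‖a n‖ : ℂ) • b n))
      (by simpa only [Lp.enorm_def] using tsum_enorm_ne_top_iff_summable_norm.2 hcoef),
    Lp.hasSum_coeFn_tsum (tsum_enorm_ne_top_iff_summable_norm.2 hval),
    ae_all_iff.2 fun n => Lp.coeFn_smul (‖a n‖ : ℂ) (b n),
    ae_all_iff.2 fun n => Lp.coeFn_smul (inner ℂ (a n) φ) (b n)] with t ht hnorm hsum hsmul hsmul'
  simp only [hsmul, hsmul', Pi.smul_apply, smul_eq_mul] at hnorm hsum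
  rw [(hasSum_nuclear hab φ).tsum_eq] at hsum
  let f : ℕ → α → ℂ := fun n s => inner ℂ (a n s) (φ s) * b n t
  have hf (n : ℕ) : Integrable (f n) μ := (L2.integrable_inner (a n) φ).mul_const _
  have hfsum : Summable fun n => ∫ s, ‖f n s‖ ∂μ := by
    refine (hnorm.mul_right ‖φ‖).of_nonneg_of_le (fun n => by positivity) fun n => ?_
    simp only [f, norm_mul, integral_mul_const, Complex.norm_real, norm_norm]
    rw [mul_right_comm]
    gcongr
    exact integral_norm_inner_le _ _
  have hfk : ∀ᵐ s ∂μ, HasSum (fun n => f n s) (k s t * φ s) := by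
    filter_upwards [hS] with s hs
    refine ((hk s hs t ht).mul_right (φ s)).congr_fun fun n => ?_
    simp only [f, RCLike.inner_apply]
    ring
  refine ⟨integrable_of_hasSum hf hfsum hfk, hsum.unique ?_⟩
  refine (hasSum_integral_of_hasSum hf hfsum hfk).congr_fun fun n => ?_
  simp only [f, integral_mul_const, L2.inner_def]

lemma isSelfAdjoint_nuclear {a b : ℕ → Lp ℂ 2 μ} (hab : Summable fun n => ‖a n‖ * ‖b n‖)
    {k : α → α → ℂ} {S : Set α} (hS : ∀ᵐ t ∂μ, t ∈ S)
    (hk : ∀ s ∈ S, ∀ t ∈ S, HasSum (fun n => starRingEnd ℂ (a n s) * b n t) (k s t))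
    (hsymm : ∀ s ∈ S, ∀ t ∈ S, starRingEnd ℂ (k t s) = k s t) :
    IsSelfAdjoint (nuclear a b) := by
  rw [ContinuousLinearMap.isSelfAdjoint_iff', adjoint_nuclear hab]
  have hba : Summable fun n => ‖b n‖ * ‖a n‖ := by simpa only [mul_comm] using hab
  have hk' : ∀ s ∈ S, ∀ t ∈ S, HasSum (fun n => starRingEnd ℂ (b n s) * a n t) (k s t) := by
    intro s hs t ht
    rw [← hsymm s hs t ht]
    refine ((hk t ht s hs).star).congr_fun fun n => ?_
    simp [mul_comm]
  ext φ : 1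
  refine Lp.ext ?_
  filter_upwards [nuclear_ae_eq_integral hab hS hk φ, nuclear_ae_eq_integral hba hS hk' φ]
    with t hab_t hba_t
  rw [hab_t.2, hba_t.2]

end NuclearKernel

section Laguerre

open Polynomial
open scoped Nat

/-- The generalized Laguerre polynomial `L_n^{(p)}`. -/
def laguerre (p n : ℕ) : ℝ[X] :=
  ∑ k ∈ Finset.range (n + 1), monomial k ((-1) ^ k * (n + p).choose (k + p) / k ! : ℝ)

lemma laguerre_coeff (p n k : ℕ) :
    (laguerre p n).coeff k = (-1) ^ k * (n + p).choose (k + p) / k ! := by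
  simp only [laguerre, finsetSum_coeff, coeff_monomial, Finset.sum_ite_eq', Finset.mem_range]
  split_ifs with h
  · rfl
  · rw [Nat.choose_eq_zero_of_lt (by omega)]
    simp

lemma laguerre_eval (p n : ℕ) (x : ℝ) : (laguerre p n).eval x =
    ∑ k ∈ Finset.range (n + 1), (-1) ^ k * (n + p).choose (k + p) / k ! * x ^ k := by
  simp [laguerre, eval_finsetSum]

lemma laguerre_eval_zero (p n : ℕ) : (laguerre p n).eval 0 = (n + p).choose p := by
  simp [← coeff_zero_eq_eval_zero, laguerre_coeff]

lemma laguerre_zero_eval (p : ℕ) (x : ℝ) : (laguerre p 0).eval x = 1 := by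
  simp [laguerre_eval]

lemma laguerre_coeff_succ (p n k : ℕ) :
    ((k : ℝ) + 1) * (k + p + 1) * (laguerre p n).coeff (k + 1) =
      (k - n) * (laguerre p n).coeff k := by
  have hchoose : ((n + p).choose (k + p + 1) : ℝ) * (k + p + 1) =
      (n + p).choose (k + p) * (n - k) := by
    rcases le_or_gt k n with h | h
    · have := Nat.choose_succ_right_eq (n + p) (k + p)
      rw [Nat.add_sub_add_right] at this
      exact_mod_cast congrArg (Nat.cast (R := ℝ)) this
    · rw [Nat.choose_eq_zero_of_lt (by omega), Nat.choose_eq_zero_of_lt (by omega)]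
      simp
  rw [laguerre_coeff, laguerre_coeff, Nat.add_right_comm, Nat.factorial_succ]
  push_cast
  field_simp
  linear_combination (-1) ^ (k + 1) * hchoose

lemma laguerre_ode (p n : ℕ) (x : ℝ) :
    x * (laguerre p n).derivative.derivative.eval x +
      (p + 1 - x) * (laguerre p n).derivative.eval x + n * (laguerre p n).eval x = 0 := by
  have hpoly : X * (laguerre p n).derivative.derivative +
      (C ((p : ℝ) + 1) * (laguerre p n).derivative - X * (laguerre p n).derivative) +
      C (n : ℝ) * laguerre p n = 0 := by
    ext k
    have hk := laguerre_coeff_succ p n k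
    rcases k with _ | k
    · simp only [Nat.cast_zero, zero_add] at hk
      simp [coeff_derivative]
      linarith
    · simp only [coeff_add, coeff_sub, coeff_X_mul, coeff_C_mul, coeff_derivative, coeff_zero]
      push_cast at hk ⊢
      linarith
  have heval := congrArg (eval x) hpoly
  simp only [eval_add, eval_sub, eval_mul, eval_X, eval_C, eval_zero] at heval
  linarith

/-- Sonin's energy of `L_n^{(p)}`, whose monotonicity bounds `L_n^{(p)}` by its value at `0`. -/
def laguerreEnergy (p n : ℕ) (x : ℝ) : ℝ :=
  (n * (laguerre p n).eval x ^ 2 + x * (laguerre p n).derivative.eval x ^ 2) * Real.exp (-2 * x)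

lemma hasDerivAt_laguerreEnergy (p n : ℕ) (x : ℝ) :
    HasDerivAt (laguerreEnergy p n)
      (-(((2 * p + 1) * (laguerre p n).derivative.eval x ^ 2 +
        2 * n * (laguerre p n).eval x ^ 2) * Real.exp (-2 * x))) x := by
  have hP := ((laguerre p n).hasDerivAt x).pow 2
  have hP' := ((laguerre p n).derivative.hasDerivAt x).pow 2
  have hexp := ((hasDerivAt_id x).const_mul (-2)).exp
  refine (((hP.const_mul (n : ℝ)).add ((hasDerivAt_id x).mul hP')).mul hexp).congr_deriv ?_
  simp only [Pi.pow_apply, Pi.add_apply, Pi.mul_apply, id]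
  linear_combination 2 * (laguerre p n).derivative.eval x * Real.exp (-2 * x) * laguerre_ode p n x

lemma antitone_laguerreEnergy (p n : ℕ) : Antitone (laguerreEnergy p n) :=
  antitone_of_hasDerivAt_nonpos (hasDerivAt_laguerreEnergy p n)
    fun x => neg_nonpos.2 (by positivity)

lemma abs_laguerre_eval_le (p n : ℕ) {x : ℝ} (hx : 0 ≤ x) :
    |(laguerre p n).eval x| ≤ (n + p).choose p * Real.exp x := by
  rcases Nat.eq_zero_or_pos n with rfl | hn
  · simpa [laguerre_zero_eval] using hx
  have henergy := antitone_laguerreEnergy p n hx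
  simp only [laguerreEnergy, mul_zero, zero_mul, add_zero, Real.exp_zero, mul_one,
    laguerre_eval_zero] at henergy
  have hsq : (laguerre p n).eval x ^ 2 * Real.exp (-2 * x) ≤ ((n + p).choose p : ℝ) ^ 2 := by
    have hn' : (0 : ℝ) < n := by exact_mod_cast hn
    have : 0 ≤ x * (laguerre p n).derivative.eval x ^ 2 * Real.exp (-2 * x) := by positivity
    refine le_of_mul_le_mul_left ?_ hn'
    linarith
  refine abs_le_of_sq_le_sq ?_ (by positivity)
  calc (laguerre p n).eval x ^ 2
      = (laguerre p n).eval x ^ 2 * Real.exp (-2 * x) * Real.exp x ^ 2 := by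
        rw [mul_assoc, ← Real.exp_nat_mul, ← Real.exp_add]
        simp
    _ ≤ ((n + p).choose p : ℝ) ^ 2 * Real.exp x ^ 2 := by gcongr
    _ = _ := by ring

end Laguerre

section BesselClifford

open scoped Nat

/-- The Bessel–Clifford function `∑ y^k / (k! (k+p)!)`, an entire function of `y` with
`J_p(2√y) = y^{p/2} besselClifford p (-y)`. -/
def besselClifford (p : ℕ) (y : ℝ) : ℝ :=
  ∑' k : ℕ, y ^ k / (k ! * (k + p)!)

lemma summable_norm_besselClifford (p : ℕ) (y : ℝ) :
    Summable fun k : ℕ => ‖y ^ k / (k ! * (k + p)! : ℝ)‖ := by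
  refine (Real.summable_pow_div_factorial |y|).of_nonneg_of_le (fun _ => norm_nonneg _) fun k => ?_
  have hfac : (1 : ℝ) ≤ (k + p)! := by exact_mod_cast (k + p).factorial_pos
  rw [norm_div, norm_pow, Real.norm_eq_abs, Real.norm_of_nonneg (by positivity)]
  gcongr
  exact le_mul_of_one_le_right (by positivity) hfac

lemma hasSum_besselClifford (p : ℕ) (y : ℝ) :
    HasSum (fun k : ℕ => y ^ k / (k ! * (k + p)!)) (besselClifford p y) :=
  (summable_norm_besselClifford p y).of_norm.hasSum

lemma hasSum_besselClifford_mul_exp (p : ℕ) (x y : ℝ) :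
    HasSum (fun n : ℕ => (laguerre p n).eval x * (y ^ n / (n + p)!))
      (besselClifford p (-(x * y)) * Real.exp y) := by
  have hexp : HasSum (fun j : ℕ => y ^ j / (j ! : ℝ)) (Real.exp y) := by
    rw [Real.exp_eq_exp_ℝ]
    exact NormedSpace.expSeries_div_hasSum_exp y
  have hexp_norm : Summable fun j : ℕ => ‖y ^ j / (j ! : ℝ)‖ := by
    simpa using Real.summable_pow_div_factorial |y|
  have hbessel := summable_norm_besselClifford p (-(x * y))
  have hcauchy :=
    (summable_norm_sum_mul_antidiagonal_of_summable_norm hbessel hexp_norm).of_norm.hasSum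
  rw [← tsum_mul_tsum_eq_tsum_sum_antidiagonal_of_summable_norm hbessel hexp_norm,
    hexp.tsum_eq] at hcauchy
  refine hcauchy.congr_fun fun n => ?_
  rw [Finset.Nat.sum_antidiagonal_eq_sum_range_succ
    fun k j => (-(x * y)) ^ k / (k ! * (k + p)! : ℝ) * (y ^ j / j !), laguerre_eval,
    Finset.sum_mul]
  refine Finset.sum_congr rfl fun k hk => ?_
  obtain ⟨j, rfl⟩ := Nat.exists_eq_add_of_le (Nat.lt_succ_iff.1 (Finset.mem_range.1 hk))
  rw [Nat.cast_choose ℝ (by omega : k + p ≤ k + j + p),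
    show k + j + p - (k + p) = j by omega, Nat.add_sub_cancel_left, neg_pow (x * y), mul_pow,
    pow_add]
  field_simp

lemma hasSum_besselClifford_laguerre (p : ℕ) (x y : ℝ) :
    HasSum (fun n : ℕ => (laguerre p n).eval x * (y ^ n / (n + p)! * Real.exp (-y)))
      (besselClifford p (-(x * y))) := by
  simpa [mul_assoc, ← Real.exp_add] using
    (hasSum_besselClifford_mul_exp p x y).mul_right (Real.exp (-y))

lemma besselKernel_eq (q : ℕ) {s t : ℝ} (hs : 0 < s) (ht : 0 < t) :
    besselKernel q s t = (s * t) ^ q * besselClifford (2 * q + 1) (-(s * t)) := by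
  have hst : 0 < s * t := mul_pos hs ht
  have hsqrt : √(s * t) ≠ 0 := (Real.sqrt_pos.2 hst).ne'
  rw [besselKernel, besselJ, besselClifford, ← tsum_div_const, ← tsum_mul_left]
  congr 1 with k
  rw [mul_div_cancel_left₀ _ two_ne_zero, show 2 * k + (2 * q + 1) = 2 * (k + q) + 1 by ring,
    pow_succ, pow_mul, Real.sq_sqrt hst.le, neg_pow (s * t), ← mul_assoc,
    mul_div_cancel_right₀ _ hsqrt]
  ring

end BesselClifford

section BesselFactors

open scoped Nat

lemma memLp_pow_mul_exp (q : ℕ) {c : ℝ} (hc : c < 1 / 2) :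
    MemLp (fun t : ℝ => t ^ q * Real.exp (c * t)) 2 mMeas := by
  rw [memLp_two_iff_integrable_sq (by fun_prop)]
  refine (integrable_pow_mul_exp (q * 2) (c := 2 * c) (by linarith)).congr (.of_forall fun t => ?_)
  simp only [mul_pow, ← pow_mul, ← Real.exp_nat_mul]
  congr 2
  push_cast
  ring

/-- The factor of `s` in the `n`-th term of the Laguerre expansion of the Bessel kernel. -/
def laguerreFactor (q n : ℕ) (s : ℝ) : ℝ :=
  s ^ q * (laguerre (2 * q + 1) n).eval (s / 3)

/-- The factor of `t` in the `n`-th term of the Laguerre expansion of the Bessel kernel. -/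
def poissonFactor (q n : ℕ) (t : ℝ) : ℝ :=
  t ^ q * ((3 * t) ^ n / (n + (2 * q + 1))! * Real.exp (-(3 * t)))

lemma hasSum_besselKernel (q : ℕ) {s t : ℝ} (hs : 0 < s) (ht : 0 < t) :
    HasSum (fun n => laguerreFactor q n s * poissonFactor q n t) (besselKernel q s t) := by
  rw [besselKernel_eq q hs ht, show s * t = s / 3 * (3 * t) by ring]
  refine ((hasSum_besselClifford_laguerre (2 * q + 1) (s / 3) (3 * t)).mul_left _).congr_fun
    fun n => ?_
  rw [laguerreFactor, poissonFactor, show s / 3 * (3 * t) = s * t by ring, mul_pow]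
  ring

lemma abs_laguerreFactor_le (q n : ℕ) {s : ℝ} (hs : 0 < s) :
    |laguerreFactor q n s| ≤
      (n + (2 * q + 1)).choose (2 * q + 1) * |s ^ q * Real.exp (1 / 3 * s)| := by
  rw [laguerreFactor, abs_mul, abs_mul, Real.abs_exp, ← mul_assoc, mul_comm _ |s ^ q|, mul_assoc,
    one_div_mul_eq_div]
  gcongr
  exact abs_laguerre_eval_le _ n (by positivity)

-- The rate `9/10` is large enough for `(10/9) * 3t - 3t = t/3` to keep the bound square integrable.
lemma abs_poissonFactor_le (q n : ℕ) {t : ℝ} (ht : 0 < t) :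
    |poissonFactor q n t| ≤ (9 / 10) ^ n * |t ^ q * Real.exp (1 / 3 * t)| := by
  have hexp : (10 / 9 * (3 * t)) ^ n / n ! ≤ Real.exp (10 / 9 * (3 * t)) :=
    Real.pow_div_factorial_le_exp _ (by positivity) n
  have hfac : (3 * t) ^ n / (n + (2 * q + 1))! ≤ (3 * t) ^ n / (n ! : ℝ) := by
    gcongr
    omega
  rw [poissonFactor, abs_of_pos (by positivity), abs_of_pos (by positivity),
    mul_left_comm ((9 / 10 : ℝ) ^ n)]
  refine mul_le_mul_of_nonneg_left ?_ (by positivity)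
  calc (3 * t) ^ n / (n + (2 * q + 1))! * Real.exp (-(3 * t))
      ≤ (3 * t) ^ n / n ! * Real.exp (-(3 * t)) := by gcongr
    _ = (9 / 10) ^ n * ((10 / 9 * (3 * t)) ^ n / n !) * Real.exp (-(3 * t)) := by
        rw [mul_pow (10 / 9), ← mul_div_assoc, ← mul_assoc, ← mul_pow]
        norm_num
    _ ≤ (9 / 10) ^ n * Real.exp (10 / 9 * (3 * t)) * Real.exp (-(3 * t)) := by gcongr
    _ = (9 / 10) ^ n * Real.exp (1 / 3 * t) := by
        rw [mul_assoc, ← Real.exp_add]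
        ring_nf

lemma memLp_laguerreFactor (q n : ℕ) :
    MemLp (fun s : ℝ => (laguerreFactor q n s : ℂ)) 2 mMeas := by
  refine (memLp_pow_mul_exp q (c := 1 / 3) (by norm_num)).of_le_mul
    (c := (n + (2 * q + 1)).choose (2 * q + 1)) ?_ ?_
  · unfold laguerreFactor
    fun_prop
  · filter_upwards [ae_mMeas_pos] with s hs
    simpa using abs_laguerreFactor_le q n hs

lemma memLp_poissonFactor (q n : ℕ) :
    MemLp (fun t : ℝ => (poissonFactor q n t : ℂ)) 2 mMeas := by
  refine (memLp_pow_mul_exp q (c := 1 / 3) (by norm_num)).of_le_mul (c := (9 / 10) ^ n) ?_ ?_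
  · unfold poissonFactor
    fun_prop
  · filter_upwards [ae_mMeas_pos] with t ht
    simpa using abs_poissonFactor_le q n ht

/-- `laguerreFactor q n` as an element of `L₂(m)`. -/
def laguerreLp (q n : ℕ) : L2m := (memLp_laguerreFactor q n).toLp _

/-- `poissonFactor q n` as an element of `L₂(m)`. -/
def poissonLp (q n : ℕ) : L2m := (memLp_poissonFactor q n).toLp _

lemma coeFn_laguerreLp (q n : ℕ) :
    laguerreLp q n =ᵐ[mMeas] fun s => (laguerreFactor q n s : ℂ) :=
  (memLp_laguerreFactor q n).coeFn_toLp

lemma coeFn_poissonLp (q n : ℕ) :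
    poissonLp q n =ᵐ[mMeas] fun t => (poissonFactor q n t : ℂ) :=
  (memLp_poissonFactor q n).coeFn_toLp

/-- The common majorant `t^q e^{t/3}` of all factors, as an element of `L₂(m)`. -/
def besselMajorant (q : ℕ) : Lp ℝ 2 mMeas :=
  (memLp_pow_mul_exp q (c := 1 / 3) (by norm_num)).toLp _

lemma coeFn_besselMajorant (q : ℕ) :
    besselMajorant q =ᵐ[mMeas] fun t => t ^ q * Real.exp (1 / 3 * t) :=
  MemLp.coeFn_toLp _

lemma norm_laguerreLp_le (q n : ℕ) :
    ‖laguerreLp q n‖ ≤ (n + (2 * q + 1)).choose (2 * q + 1) * ‖besselMajorant q‖ := by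
  refine Lp.norm_le_mul_norm_of_ae_le_mul ?_
  filter_upwards [ae_mMeas_pos, coeFn_laguerreLp q n, coeFn_besselMajorant q] with s hs hsl hsW
  rw [hsl, hsW, Complex.norm_real]
  exact abs_laguerreFactor_le q n hs

lemma norm_poissonLp_le (q n : ℕ) : ‖poissonLp q n‖ ≤ (9 / 10) ^ n * ‖besselMajorant q‖ := by
  refine Lp.norm_le_mul_norm_of_ae_le_mul ?_
  filter_upwards [ae_mMeas_pos, coeFn_poissonLp q n, coeFn_besselMajorant q] with t ht htp htW
  rw [htp, htW, Complex.norm_real]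
  exact abs_poissonFactor_le q n ht

lemma summable_norm_besselFactors (q : ℕ) :
    Summable fun n => ‖laguerreLp q n‖ * ‖poissonLp q n‖ := by
  have hgeom : Summable fun n : ℕ =>
      ((n + (2 * q + 1)).choose (2 * q + 1) : ℝ) * (9 / 10) ^ n * ‖besselMajorant q‖ ^ 2 :=
    (summable_choose_mul_geometric_of_norm_lt_one (R := ℝ) (r := 9 / 10) (2 * q + 1)
      (by norm_num)).mul_right _
  refine hgeom.of_nonneg_of_le (fun n => by positivity) fun n => ?_
  calc ‖laguerreLp q n‖ * ‖poissonLp q n‖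
      ≤ ((n + (2 * q + 1)).choose (2 * q + 1) * ‖besselMajorant q‖) *
          ((9 / 10) ^ n * ‖besselMajorant q‖) := by
        gcongr
        exacts [norm_laguerreLp_le q n, norm_poissonLp_le q n]
    _ = _ := by ring

end BesselFactors

section BesselOperator

/-- The integral operator `B_q` on `L₂(m)` with kernel `J_{2q+1}(2√(st)) / √(st)`, defined by the
Laguerre expansion of this kernel. -/
def besselOp (q : ℕ) : L2m →L[ℂ] L2m :=
  nuclear (laguerreLp q) (poissonLp q)

lemma isTraceClass_besselOp (q : ℕ) : IsTraceClass (besselOp q) :=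
  isTraceClass_nuclear (summable_norm_besselFactors q)

/-- The points at which the `L²` classes of all factors take the expected values. -/
def besselFactorSet (q : ℕ) : Set ℝ :=
  {t | 0 < t ∧ ∀ n, laguerreLp q n t = laguerreFactor q n t ∧
    poissonLp q n t = poissonFactor q n t}

lemma ae_mem_besselFactorSet (q : ℕ) : ∀ᵐ t ∂mMeas, t ∈ besselFactorSet q := by
  filter_upwards [ae_mMeas_pos, ae_all_iff.2 fun n => coeFn_laguerreLp q n,
    ae_all_iff.2 fun n => coeFn_poissonLp q n] with t ht hl hp
  exact ⟨ht, fun n => ⟨hl n, hp n⟩⟩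

lemma hasSum_besselKernel_of_mem (q : ℕ) :
    ∀ s ∈ besselFactorSet q, ∀ t ∈ besselFactorSet q,
      HasSum (fun n => starRingEnd ℂ (laguerreLp q n s) *
        poissonLp q n t) (besselKernel q s t : ℂ) := by
  rintro s ⟨hs, hs'⟩ t ⟨ht, ht'⟩
  simp only [hs', ht', Complex.conj_ofReal]
  exact_mod_cast hasSum_besselKernel q hs ht

lemma besselOp_ae_eq_integral (q : ℕ) (φ : L2m) :
    ∀ᵐ t ∂mMeas, Integrable (fun s : ℝ => (besselKernel q s t : ℂ) * φ s) mMeas ∧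
      besselOp q φ t = ∫ s : ℝ, (besselKernel q s t : ℂ) * φ s ∂mMeas :=
  nuclear_ae_eq_integral (summable_norm_besselFactors q) (ae_mem_besselFactorSet q)
    (hasSum_besselKernel_of_mem q) φ

lemma isSelfAdjoint_besselOp (q : ℕ) : IsSelfAdjoint (besselOp q) := by
  refine isSelfAdjoint_nuclear (summable_norm_besselFactors q) (ae_mem_besselFactorSet q)
    (hasSum_besselKernel_of_mem q) fun s _ t _ => ?_
  rw [Complex.conj_ofReal, besselKernel, besselKernel, mul_comm t s]

end BesselOperator

section LaplaceIntegrals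

open scoped Nat

variable {u : ℂ}

lemma norm_pow_mul_cexp (m : ℕ) {t : ℝ} (ht : 0 < t) (u : ℂ) :
    ‖(t : ℂ) ^ m * Complex.exp (-(t * u))‖ = t ^ m * Real.exp (-u.re * t) := by
  rw [norm_mul, norm_pow, Complex.norm_real, Real.norm_of_nonneg ht.le, Complex.norm_exp]
  simp [mul_comm]

lemma integrableOn_pow_mul_cexp (m : ℕ) (hu : 0 < u.re) :
    IntegrableOn (fun t : ℝ => (t : ℂ) ^ m * Complex.exp (-(t * u))) (Ioi 0) := by
  have hexp := integrableOn_rpow_mul_exp_neg_mul_rpow (s := m) (p := 1)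
    (by linarith [m.cast_nonneg (α := ℝ)]) one_pos hu
  refine Integrable.mono' hexp (by fun_prop) ?_
  filter_upwards [ae_restrict_mem measurableSet_Ioi] with t ht
  rw [norm_pow_mul_cexp m ht, Real.rpow_natCast, Real.rpow_one]

lemma tendsto_pow_mul_cexp_atTop (m : ℕ) (hu : 0 < u.re) :
    Tendsto (fun t : ℝ => (t : ℂ) ^ m * Complex.exp (-(t * u))) atTop (𝓝 0) := by
  rw [tendsto_zero_iff_norm_tendsto_zero]
  refine (tendsto_rpow_mul_exp_neg_mul_atTop_nhds_zero m u.re hu).congr' ?_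
  filter_upwards [eventually_gt_atTop 0] with t ht
  rw [norm_pow_mul_cexp m ht, Real.rpow_natCast]

lemma hasDerivAt_pow_succ_mul_cexp (m : ℕ) (u : ℂ) (t : ℝ) :
    HasDerivAt (fun t : ℝ => (t : ℂ) ^ (m + 1) * Complex.exp (-(t * u)))
      ((m + 1) * ((t : ℂ) ^ m * Complex.exp (-(t * u))) -
        u * ((t : ℂ) ^ (m + 1) * Complex.exp (-(t * u)))) t := by
  have hofReal := Complex.ofRealCLM.hasDerivAt (x := t)
  refine ((hofReal.pow (m + 1)).mul (hofReal.mul_const u).neg.cexp).congr_deriv ?_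
  simp
  ring

lemma mul_integral_pow_succ_mul_cexp (m : ℕ) (hu : 0 < u.re) :
    u * ∫ t : ℝ in Ioi 0, (t : ℂ) ^ (m + 1) * Complex.exp (-(t * u)) =
      (m + 1) * ∫ t : ℝ in Ioi 0, (t : ℂ) ^ m * Complex.exp (-(t * u)) := by
  have hint := (integrableOn_pow_mul_cexp m hu).const_mul (m + 1)
  have hint' := (integrableOn_pow_mul_cexp (m + 1) hu).const_mul u
  have hparts := integral_Ioi_of_hasDerivAt_of_tendsto'
    (fun t _ => hasDerivAt_pow_succ_mul_cexp m u t) (hint.sub hint')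
    (tendsto_pow_mul_cexp_atTop (m + 1) hu)
  rw [integral_sub hint hint', integral_const_mul, integral_const_mul] at hparts
  exact (sub_eq_zero.1 (by simpa using hparts)).symm

lemma integral_pow_mul_cexp (m : ℕ) (hu : 0 < u.re) :
    ∫ t : ℝ in Ioi 0, (t : ℂ) ^ m * Complex.exp (-(t * u)) = m ! / u ^ (m + 1) := by
  have hu0 : u ≠ 0 := fun h => by simp [h] at hu
  induction m with
  | zero =>
    simpa [mul_comm, neg_div] using integral_exp_mul_complex_Ioi (a := -u) (by simpa using hu) 0
  | succ m ih =>
    refine mul_left_cancel₀ hu0 ((mul_integral_pow_succ_mul_cexp m hu).trans ?_)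
    rw [ih, Nat.factorial_succ]
    push_cast
    field_simp
    ring

lemma integral_norm_pow_mul_cexp (m : ℕ) (hu : 0 < u.re) :
    ∫ t : ℝ in Ioi 0, ‖(t : ℂ) ^ m * Complex.exp (-(t * u))‖ = m ! / u.re ^ (m + 1) := by
  have hGamma := Real.integral_rpow_mul_exp_neg_mul_Ioi (a := m + 1) (by positivity) hu
  rw [Real.Gamma_nat_eq_factorial, add_sub_cancel_right, ← Nat.cast_succ, Real.rpow_natCast,
    one_div, inv_pow, inv_mul_eq_div] at hGamma
  rw [← hGamma]
  refine setIntegral_congr_fun measurableSet_Ioi fun t ht => ?_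
  simp only [norm_pow_mul_cexp m ht, Real.rpow_natCast, neg_mul]

lemma integral_pow_mul_cexp_mul_besselClifford (p : ℕ) (s : ℝ) (hu : 0 < u.re) :
    ∫ t : ℝ in Ioi 0, (t : ℂ) ^ p * Complex.exp (-(t * u)) * besselClifford p (-(s * t)) =
      Complex.exp (-(s * (1 / u))) / u ^ (p + 1) := by
  have hu0 : u ≠ 0 := fun h => by simp [h] at hu
  let c : ℕ → ℂ := fun k => (-s) ^ k / (k ! * (k + p)!)
  let f : ℕ → ℝ → ℂ := fun k t => c k * ((t : ℂ) ^ (k + p) * Complex.exp (-(t * u)))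
  have hf (k : ℕ) : IntegrableOn (f k) (Ioi 0) :=
    (integrableOn_pow_mul_cexp (k + p) hu).const_mul _
  have hnorm (k : ℕ) :
      ∫ t in Ioi 0, ‖f k t‖ = (|s| / u.re) ^ k / k ! * (1 / u.re ^ (p + 1)) := by
    simp only [f, norm_mul (c k), integral_const_mul, integral_norm_pow_mul_cexp _ hu]
    simp only [c, norm_div, norm_mul, norm_pow, norm_neg, Complex.norm_natCast, Complex.norm_real,
      Real.norm_eq_abs, div_pow, add_assoc k p 1, pow_add]
    field_simp
  have hintegral (k : ℕ) :
      ∫ t in Ioi 0, f k t = (-(s * (1 / u))) ^ k / k ! * (1 / u ^ (p + 1)) := by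
    simp only [f, integral_const_mul, integral_pow_mul_cexp _ hu, c]
    have hfac : ((k + p)! : ℂ) ≠ 0 := by exact_mod_cast (k + p).factorial_ne_zero
    rw [show -((s : ℂ) * (1 / u)) = -s / u by ring, div_pow, add_assoc k p 1, pow_add u]
    field_simp
  have hexp := NormedSpace.expSeries_div_hasSum_exp (-(s * (1 / u)))
  rw [← Complex.exp_eq_exp_ℂ] at hexp
  rw [div_eq_mul_one_div]
  refine (hasSum_integral_of_hasSum hf ?_ ?_).unique
    ((hexp.mul_right _).congr_fun hintegral)
  · simpa only [hnorm] using (Real.summable_pow_div_factorial _).mul_right _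
  · refine .of_forall fun t => ?_
    refine ((Complex.hasSum_ofReal.2 (hasSum_besselClifford p (-(s * t)))).mul_left _).congr_fun
      fun k => ?_
    simp only [f, c]
    push_cast
    ring

lemma exp_sub_one_pos {t : ℝ} (ht : 0 < t) : 0 < Real.exp t - 1 :=
  sub_pos.2 (Real.one_lt_exp_iff.2 ht)

lemma integral_mMeas_exp_sub_one_mul (g : ℝ → ℂ) :
    ∫ t : ℝ, (Complex.exp t - 1) * g t ∂mMeas = ∫ t : ℝ in Ioi 0, t * g t := by
  rw [mMeas, integral_withDensity_eq_integral_toReal_smul (by fun_prop) (by simp)]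
  refine setIntegral_congr_fun measurableSet_Ioi fun t (ht : 0 < t) => ?_
  have hexp := exp_sub_one_pos ht
  have hexp' : Complex.exp t - 1 ≠ 0 := by exact_mod_cast hexp.ne'
  simp only [ENNReal.toReal_ofReal (div_pos ht hexp).le, Complex.real_smul]
  push_cast
  field_simp

end LaplaceIntegrals

section LaplaceBessel

variable (q : ℕ) {u : ℂ}

lemma integral_laplaceKernel_mul_besselKernel {s : ℝ} (hs : 0 < s) (hu : 0 < u.re) :
    ∫ t : ℝ, (Complex.exp t - 1) * (Complex.exp (-(t * u)) * (t : ℂ) ^ q) *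
      besselKernel q s t ∂mMeas =
    (1 / u ^ 2) ^ (1 + q) * (Complex.exp (-(s * (1 / u))) * (s : ℂ) ^ q) := by
  simp only [mul_assoc]
  rw [integral_mMeas_exp_sub_one_mul]
  calc ∫ t : ℝ in Ioi 0, t * (Complex.exp (-(t * u)) * ((t : ℂ) ^ q * besselKernel q s t))
      = ∫ t : ℝ in Ioi 0, (s : ℂ) ^ q * ((t : ℂ) ^ (2 * q + 1) * Complex.exp (-(t * u)) *
          besselClifford (2 * q + 1) (-(s * t))) := by
        refine setIntegral_congr_fun measurableSet_Ioi fun t ht => ?_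
        simp only [besselKernel_eq q hs ht]
        push_cast
        ring
    _ = _ := by
        rw [integral_const_mul, integral_pow_mul_cexp_mul_besselClifford _ _ hu, div_pow, one_pow,
          ← pow_mul, show 2 * (1 + q) = 2 * q + 1 + 1 by ring]
        ring

lemma memLp_exp_sub_one_mul_laplaceKernel (hu : 1 / 2 < u.re) :
    MemLp (fun t : ℝ => (Complex.exp t - 1) * (Complex.exp (-(t * u)) * (t : ℂ) ^ q)) 2 mMeas := by
  have hshift : -(1 / 2) < (u - 1).re := by
    rw [Complex.sub_re, Complex.one_re]
    linarith
  refine ((memLp_kernel q ⟨u - 1, hshift⟩).sub (memLp_kernel q ⟨u, by linarith⟩)).ae_eq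
    (.of_forall fun t => ?_)
  simp only [Pi.sub_apply, mul_sub, mul_one, neg_sub, Complex.exp_sub, Complex.exp_neg]
  ring

lemma besselOp_exp_sub_one_mul_laplaceKernel (hu : 1 / 2 < u.re) :
    besselOp q (memLp_exp_sub_one_mul_laplaceKernel q hu).toLp =ᵐ[mMeas] fun s =>
      (1 / u ^ 2) ^ (1 + q) * (Complex.exp (-(s * (1 / u))) * (s : ℂ) ^ q) := by
  have hLp := (memLp_exp_sub_one_mul_laplaceKernel q hu).coeFn_toLp
  filter_upwards [besselOp_ae_eq_integral q (memLp_exp_sub_one_mul_laplaceKernel q hu).toLp,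
    ae_mMeas_pos] with s hB hs
  rw [hB.2, ← integral_laplaceKernel_mul_besselKernel q hs (by linarith)]
  refine integral_congr_ae ?_
  filter_upwards [hLp] with t ht
  rw [ht, besselKernel, besselKernel, mul_comm t s, mul_comm]

-- `B_q` is self-adjoint, so it can be moved onto the explicit kernel.
lemma integral_laplaceKernel_mul_besselOp (φ : L2m) (hu : 1 / 2 < u.re) :
    ∫ t : ℝ, (Complex.exp t - 1) * (Complex.exp (-(t * u)) * (t : ℂ) ^ q) * besselOp q φ t ∂mMeas =
      (1 / u ^ 2) ^ (1 + q) * ∫ s : ℝ, Complex.exp (-(s * (1 / u))) * (s : ℂ) ^ q * φ s ∂mMeas := by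
  have hconj : 1 / 2 < (starRingEnd ℂ u).re := by rwa [Complex.conj_re]
  let h : L2m := (memLp_exp_sub_one_mul_laplaceKernel q hconj).toLp
  have hsymm : inner ℂ h (besselOp q φ) = inner ℂ (besselOp q h) φ :=
    ((isSelfAdjoint_besselOp q).isSymmetric h φ).symm
  rw [L2.inner_def, L2.inner_def] at hsymm
  rw [← integral_const_mul]
  convert hsymm using 1 <;> refine integral_congr_ae ?_
  · filter_upwards [(memLp_exp_sub_one_mul_laplaceKernel q hconj).coeFn_toLp] with t ht
    rw [RCLike.inner_apply', ht]
    simp [← Complex.exp_conj]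
  · filter_upwards [besselOp_exp_sub_one_mul_laplaceKernel q hconj] with s hs
    rw [RCLike.inner_apply', hs]
    simp [← Complex.exp_conj, mul_assoc]

end LaplaceBessel

section IsMultiplicationBy

variable {α : Type*} [MeasurableSpace α] {μ : Measure α}

/-- `T` is the operator of multiplication by the function `g` on `L²`. -/
def IsMultiplicationBy (T : Lp ℂ 2 μ →L[ℂ] Lp ℂ 2 μ) (g : α → ℂ) : Prop :=
  ∀ φ : Lp ℂ 2 μ, T φ =ᵐ[μ] fun t => g t * φ t

namespace IsMultiplicationBy

variable {S T : Lp ℂ 2 μ →L[ℂ] Lp ℂ 2 μ} {f g : α → ℂ}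

lemma one : IsMultiplicationBy (1 : Lp ℂ 2 μ →L[ℂ] Lp ℂ 2 μ) 1 := fun φ => by simp

lemma sub (hS : IsMultiplicationBy S f) (hT : IsMultiplicationBy T g) :
    IsMultiplicationBy (S - T) (f - g) := fun φ => by
  filter_upwards [hS φ, hT φ, Lp.coeFn_sub (S φ) (T φ)] with t ht ht' hsub
  rw [sub_apply, hsub, Pi.sub_apply, ht, ht', Pi.sub_apply, sub_mul]

lemma const_smul (hT : IsMultiplicationBy T g) (c : ℂ) : IsMultiplicationBy (c • T) (c • g) :=
  fun φ => by
    filter_upwards [hT φ, Lp.coeFn_smul c (T φ)] with t ht hsmul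
    rw [smul_apply, hsmul, Pi.smul_apply, ht, Pi.smul_apply, smul_mul_assoc]

lemma mul (hS : IsMultiplicationBy S f) (hT : IsMultiplicationBy T g) :
    IsMultiplicationBy (S * T) (f * g) := fun φ => by
  filter_upwards [hS (T φ), hT φ] with t ht ht'
  rw [mul_apply_eq_comp, ht, ht', Pi.mul_apply, mul_assoc]

lemma congr (hT : IsMultiplicationBy T f) (h : f =ᵐ[μ] g) : IsMultiplicationBy T g := fun φ => by
  filter_upwards [hT φ, h] with t ht hfg
  rw [ht, hfg]

lemma unique (hS : IsMultiplicationBy S g) (hT : IsMultiplicationBy T g) : S = T := by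
  ext φ : 1
  exact Lp.ext ((hS φ).trans (hT φ).symm)

lemma exists_of_memLp_top (hg : MemLp g ∞ μ) :
    ∃ T : Lp ℂ 2 μ →L[ℂ] Lp ℂ 2 μ, IsMultiplicationBy T g := by
  refine ⟨(ContinuousLinearMap.mul ℂ ℂ).holderL μ ∞ 2 2 (hg.toLp g), fun φ => ?_⟩
  filter_upwards [(ContinuousLinearMap.mul ℂ ℂ).coeFn_holder (r := 2) (hg.toLp g) φ,
    hg.coeFn_toLp] with t ht hgt
  exact ht.trans (by rw [hgt, ContinuousLinearMap.mul_apply'])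

lemma isUnit (hT : IsMultiplicationBy T g) (hg : AEStronglyMeasurable g μ) {c : ℝ} (hc : 0 < c)
    (hcg : ∀ᵐ t ∂μ, c ≤ ‖g t‖) : IsUnit T := by
  have hinv : ∀ᵐ t ∂μ, ‖(g t)⁻¹‖ ≤ c⁻¹ := by
    filter_upwards [hcg] with t ht
    rw [norm_inv]
    gcongr
  obtain ⟨S, hS⟩ := exists_of_memLp_top
    (memLp_top_of_bound hg.aemeasurable.inv.aestronglyMeasurable _ hinv)
  have hne : ∀ᵐ t ∂μ, g t ≠ 0 := hcg.mono fun t ht => norm_pos_iff.1 (hc.trans_le ht)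
  refine ⟨⟨T, S, ((hT.mul hS).congr ?_).unique one, ((hS.mul hT).congr ?_).unique one⟩, rfl⟩ <;>
    filter_upwards [hne] with t ht <;> simp [ht]

lemma ringInverse (hT : IsMultiplicationBy T g) (hunit : IsUnit T) (hg : ∀ᵐ t ∂μ, g t ≠ 0) :
    IsMultiplicationBy (Ring.inverse T) g⁻¹ := fun φ => by
  filter_upwards [hT (Ring.inverse T φ), hg] with t ht hgt
  rw [← mul_apply_eq_comp, Ring.mul_inverse_cancel T hunit, one_apply_eq_self] at ht
  rw [Pi.inv_apply, ht, inv_mul_cancel_left₀ hgt]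

lemma opNorm_le (hT : IsMultiplicationBy T g) {C : ℝ} (hC : 0 ≤ C) (hg : ∀ᵐ t ∂μ, ‖g t‖ ≤ C) :
    ‖T‖ ≤ C := by
  refine T.opNorm_le_bound hC fun φ => Lp.norm_le_mul_norm_of_ae_le_mul ?_
  filter_upwards [hT φ, hg] with t ht hgt
  rw [ht, norm_mul]
  gcongr

lemma norm_apply_sq (hT : IsMultiplicationBy T g) (φ : Lp ℂ 2 μ) :
    ‖T φ‖ ^ 2 = ∫ t, ‖g t * φ t‖ ^ 2 ∂μ := by
  have hinner := inner_self_eq_norm_sq_to_K (𝕜 := ℂ) (T φ)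
  rw [L2.inner_def] at hinner
  simp only [inner_self_eq_norm_sq_to_K, Complex.coe_algebraMap, ← Complex.ofReal_pow] at hinner
  rw [integral_complex_ofReal, Complex.ofReal_inj] at hinner
  rw [← hinner]
  refine integral_congr_ae ?_
  filter_upwards [hT φ] with t ht
  rw [ht]

lemma tendsto_apply {ι : Type*} {l : Filter ι} [l.IsCountablyGenerated]
    {T : ι → Lp ℂ 2 μ →L[ℂ] Lp ℂ 2 μ} {T₀ : Lp ℂ 2 μ →L[ℂ] Lp ℂ 2 μ} {g : ι → α → ℂ} {g₀ : α → ℂ}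
    {C : ℝ} (hT : ∀ᶠ i in l, IsMultiplicationBy (T i) (g i)) (hT₀ : IsMultiplicationBy T₀ g₀)
    (hmeas : ∀ᶠ i in l, AEStronglyMeasurable (fun t => g i t - g₀ t) μ)
    (hbound : ∀ᶠ i in l, ∀ᵐ t ∂μ, ‖g i t - g₀ t‖ ≤ C)
    (hlim : ∀ᵐ t ∂μ, Tendsto (fun i => g i t) l (𝓝 (g₀ t))) (φ : Lp ℂ 2 μ) :
    Tendsto (fun i => T i φ) l (𝓝 (T₀ φ)) := by
  have hsq : Tendsto (fun i => ∫ t, ‖(g i t - g₀ t) * φ t‖ ^ 2 ∂μ) l (𝓝 (∫ _, (0 : ℝ) ∂μ)) := by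
    have hφ := (memLp_two_iff_integrable_sq_norm (Lp.aestronglyMeasurable φ)).1 (Lp.memLp φ)
    refine tendsto_integral_filter_of_dominated_convergence (fun t => C ^ 2 * ‖φ t‖ ^ 2)
      ?_ ?_ (hφ.const_mul _) ?_
    · filter_upwards [hmeas] with i hi
      exact (hi.mul (Lp.aestronglyMeasurable φ)).norm.pow 2
    · filter_upwards [hbound] with i hi
      filter_upwards [hi] with t ht
      rw [Real.norm_of_nonneg (by positivity), norm_mul, mul_pow]
      gcongr
    · filter_upwards [hlim] with t ht
      simpa using ((ht.sub_const (g₀ t)).mul_const (φ t)).norm.pow 2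
  rw [integral_zero] at hsq
  rw [tendsto_iff_norm_sub_tendsto_zero]
  have hnorm := (hsq.congr' (hT.mono fun i hi => ((hi.sub hT₀).norm_apply_sq φ).symm)).sqrt
  simpa using hnorm

end IsMultiplicationBy

end IsMultiplicationBy

section CutPlane

variable {z : ℂ} {θ : ℝ}

lemma mem_cutPlane_iff_arg_ne_pi : z ∈ cutPlane ↔ (1 - z).arg ≠ Real.pi := by
  rw [Ne, Complex.arg_eq_pi_iff]
  simp [cutPlane]

lemma mem_cutPlane_of_abs_arg_le (hθ : θ < Real.pi) (hz : |(1 - z).arg| ≤ θ) : z ∈ cutPlane :=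
  mem_cutPlane_iff_arg_ne_pi.2 fun h => (((le_abs_self _).trans hz).trans_lt hθ).ne h

lemma mem_cutPlane_of_norm_le_one (hz : ‖z‖ ≤ 1) : z ∈ cutPlane := fun h =>
  h.1.not_ge ((Complex.re_le_norm z).trans hz)

lemma mem_openCutPlane_iff_mem_slitPlane : z ∈ openCutPlane ↔ 1 - z ∈ Complex.slitPlane := by
  rw [Complex.mem_slitPlane_iff_not_le_zero]
  simp [openCutPlane, Complex.le_def]

lemma isOpen_openCutPlane : IsOpen openCutPlane := by
  have hpreimage : openCutPlane = (fun z : ℂ => 1 - z) ⁻¹' Complex.slitPlane :=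
    Set.ext fun _ => mem_openCutPlane_iff_mem_slitPlane
  rw [hpreimage]
  exact Complex.isOpen_slitPlane.preimage (by fun_prop)

lemma mem_openCutPlane_iff : z ∈ openCutPlane ↔ z ∈ cutPlane ∧ z ≠ 1 := by
  rw [mem_openCutPlane_iff_mem_slitPlane, Complex.mem_slitPlane_iff_arg,
    mem_cutPlane_iff_arg_ne_pi, sub_ne_zero, ne_comm (a := (1 : ℂ))]

lemma cos_half_arg_pos (hz : z ∈ cutPlane) : 0 < Real.cos ((1 - z).arg / 2) := by
  have hlt := (Complex.arg_le_pi (1 - z)).lt_of_ne (mem_cutPlane_iff_arg_ne_pi.1 hz)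
  have hgt := Complex.neg_pi_lt_arg (1 - z)
  exact Real.cos_pos_of_mem_Ioo ⟨by linarith, by linarith⟩

lemma cos_half_le_cos_half_arg (hθ : θ < Real.pi) (hz : |(1 - z).arg| ≤ θ) :
    Real.cos (θ / 2) ≤ Real.cos ((1 - z).arg / 2) := by
  rw [← Real.cos_abs ((1 - z).arg / 2), abs_div, abs_two]
  exact Real.cos_le_cos_of_nonneg_of_le_pi (by positivity) (by linarith [Real.pi_pos])
    (by linarith)

end CutPlane

section Multiplier

variable {z : ℂ} {t : ℝ}

lemma one_sub_exp_neg_pos (ht : 0 < t) : 0 < 1 - Real.exp (-t) :=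
  sub_pos.2 (Real.exp_lt_one_iff.2 (neg_lt_zero.2 ht))

lemma norm_one_sub_cexp_neg (ht : 0 < t) :
    ‖1 - Complex.exp (-(t : ℂ))‖ = 1 - Real.exp (-t) := by
  rw [show 1 - Complex.exp (-(t : ℂ)) = ((1 - Real.exp (-t) : ℝ) : ℂ) by push_cast; rfl,
    Complex.norm_of_nonneg (one_sub_exp_neg_pos ht).le]

/-- The function `(1 - e^{-t}) / (1 - z e^{-t})`, by which `(1 - M)(1 - zM)⁻¹` multiplies. -/
def multiplier (z : ℂ) (t : ℝ) : ℂ :=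
  (1 - Complex.exp (-(t : ℂ))) / (1 - z * Complex.exp (-(t : ℂ)))

lemma measurable_multiplier (z : ℂ) : Measurable (multiplier z) := by
  unfold multiplier
  fun_prop

lemma cos_half_arg_mul_le_norm_add_mul (u : ℂ) (a c : ℝ) :
    Real.cos (u.arg / 2) * (a + c * ‖u‖) ≤ ‖(a : ℂ) + c * u‖ := by
  -- Rotating by half the argument of `u` makes both summands have argument `± arg u / 2`.
  set β : ℝ := u.arg / 2 with hβ
  have hrotate : Complex.exp ((-β : ℝ) * Complex.I) * ((a : ℂ) + c * u) =
      (a : ℝ) * Complex.exp ((-β : ℝ) * Complex.I) +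
        ((c * ‖u‖ : ℝ) : ℂ) * Complex.exp (β * Complex.I) := by
    have hexp : Complex.exp ((-β : ℝ) * Complex.I) * Complex.exp (u.arg * Complex.I) =
        Complex.exp (β * Complex.I) := by
      rw [← Complex.exp_add, hβ]
      congr 1
      push_cast
      ring
    rw [← hexp, Complex.ofReal_mul]
    linear_combination (-(Complex.exp ((-β : ℝ) * Complex.I) * c)) *
      Complex.norm_mul_exp_arg_mul_I u
  calc Real.cos β * (a + c * ‖u‖)
      = (Complex.exp ((-β : ℝ) * Complex.I) * ((a : ℂ) + c * u)).re := by
        rw [hrotate, Complex.add_re, Complex.re_ofReal_mul, Complex.re_ofReal_mul,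
          Complex.exp_ofReal_mul_I_re, Complex.exp_ofReal_mul_I_re, Real.cos_neg]
        ring
    _ ≤ ‖Complex.exp ((-β : ℝ) * Complex.I) * ((a : ℂ) + c * u)‖ := Complex.re_le_norm _
    _ = ‖(a : ℂ) + c * u‖ := by rw [norm_mul, Complex.norm_exp_ofReal_mul_I, one_mul]

lemma cos_half_arg_mul_le_norm_one_sub (z : ℂ) (t : ℝ) :
    Real.cos ((1 - z).arg / 2) * ((1 - Real.exp (-t)) + Real.exp (-t) * ‖1 - z‖) ≤
      ‖1 - z * Complex.exp (-(t : ℂ))‖ := by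
  refine (cos_half_arg_mul_le_norm_add_mul (1 - z) _ _).trans_eq (congrArg _ ?_)
  push_cast
  ring

lemma cos_half_arg_mul_one_sub_exp_le (hz : z ∈ cutPlane) (t : ℝ) :
    Real.cos ((1 - z).arg / 2) * (1 - Real.exp (-t)) ≤ ‖1 - z * Complex.exp (-(t : ℂ))‖ := by
  have hcos := cos_half_arg_pos hz
  refine le_trans ?_ (cos_half_arg_mul_le_norm_one_sub z t)
  gcongr
  exact le_add_of_nonneg_right (by positivity)

lemma one_sub_mul_cexp_ne_zero (hz : z ∈ cutPlane) (ht : 0 < t) :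
    1 - z * Complex.exp (-(t : ℂ)) ≠ 0 :=
  norm_pos_iff.1 ((mul_pos (cos_half_arg_pos hz) (one_sub_exp_neg_pos ht)).trans_le
    (cos_half_arg_mul_one_sub_exp_le hz t))

lemma norm_multiplier_le (hz : z ∈ cutPlane) (ht : 0 < t) :
    ‖multiplier z t‖ ≤ (Real.cos ((1 - z).arg / 2))⁻¹ := by
  rw [multiplier, norm_div, norm_one_sub_cexp_neg ht,
    div_le_iff₀ (norm_pos_iff.2 (one_sub_mul_cexp_ne_zero hz ht)), inv_mul_eq_div,
    le_div_iff₀' (cos_half_arg_pos hz)]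
  exact cos_half_arg_mul_one_sub_exp_le hz t

lemma norm_multiplier_le_of_abs_arg_le {θ : ℝ} (hθ : θ < Real.pi) (hz : |(1 - z).arg| ≤ θ)
    (ht : 0 < t) : ‖multiplier z t‖ ≤ (Real.cos (θ / 2))⁻¹ := by
  have hθ₀ : 0 ≤ θ := (abs_nonneg _).trans hz
  have hcos : 0 < Real.cos (θ / 2) := Real.cos_pos_of_mem_Ioo ⟨by linarith, by linarith⟩
  exact (norm_multiplier_le (mem_cutPlane_of_abs_arg_le hθ hz) ht).trans
    (inv_anti₀ hcos (cos_half_le_cos_half_arg hθ hz))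

lemma multiplier_one (ht : 0 < t) : multiplier 1 t = 1 := by
  have hne := one_sub_mul_cexp_ne_zero (mem_cutPlane_of_norm_le_one norm_one.le) ht
  rw [one_mul] at hne
  rw [multiplier, one_mul, div_self hne]

lemma continuousAt_multiplier (hz : z ∈ cutPlane) (ht : 0 < t) :
    ContinuousAt (fun z => multiplier z t) z := by
  unfold multiplier
  exact continuousAt_const.div (by fun_prop) (one_sub_mul_cexp_ne_zero hz ht)

end Multiplier

section MultiplierOp

variable {z : ℂ}

lemma isMultiplicationBy_one_sub_smul_mulM (z : ℂ) :
    IsMultiplicationBy (1 - z • mulM : L2m →L[ℂ] L2m) fun t => 1 - z * Complex.exp (-(t : ℂ)) :=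
  IsMultiplicationBy.one.sub ((show IsMultiplicationBy mulM _ from mulM_apply).const_smul z)

lemma isUnit_one_sub_smul_mulM (hz : z ∈ cutPlane) (hz₁ : z ≠ 1) : IsUnit (1 - z • mulM) := by
  have hnorm : 0 < ‖1 - z‖ := norm_pos_iff.2 (sub_ne_zero.2 hz₁.symm)
  have hcos := cos_half_arg_pos hz
  refine (isMultiplicationBy_one_sub_smul_mulM z).isUnit (by fun_prop)
    (mul_pos hcos (lt_min one_pos hnorm)) ?_
  filter_upwards [ae_mMeas_pos] with t ht
  refine le_trans ?_ (cos_half_arg_mul_le_norm_one_sub z t)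
  gcongr
  calc min 1 ‖1 - z‖ = (1 - Real.exp (-t)) * min 1 ‖1 - z‖ + Real.exp (-t) * min 1 ‖1 - z‖ := by
        ring
    _ ≤ (1 - Real.exp (-t)) * 1 + Real.exp (-t) * ‖1 - z‖ := by
        have := one_sub_exp_neg_pos ht
        gcongr
        exacts [min_le_left _ _, min_le_right _ _]
    _ = _ := by rw [mul_one]

/-- The operator `(1 - M)(1 - zM)⁻¹`, read as the identity at `z = 1`, where `1 - zM` is not
invertible. -/
def multiplierOp (z : ℂ) : L2m →L[ℂ] L2m :=
  if z = 1 then 1 else (1 - mulM) * Ring.inverse (1 - z • mulM)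

lemma multiplierOp_of_ne_one (hz : z ≠ 1) :
    multiplierOp z = (1 - mulM) * Ring.inverse (1 - z • mulM) := if_neg hz

lemma isMultiplicationBy_multiplierOp (hz : z ∈ cutPlane) :
    IsMultiplicationBy (multiplierOp z) (multiplier z) := by
  rcases eq_or_ne z 1 with rfl | hz₁
  · rw [multiplierOp, if_pos rfl]
    refine IsMultiplicationBy.one.congr ?_
    filter_upwards [ae_mMeas_pos] with t ht
    rw [multiplier_one ht, Pi.one_apply]
  · have hinverse := (isMultiplicationBy_one_sub_smul_mulM z).ringInverse
      (isUnit_one_sub_smul_mulM hz hz₁)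
      (ae_mMeas_pos.mono fun t ht => one_sub_mul_cexp_ne_zero hz ht)
    have hmul := (isMultiplicationBy_one_sub_smul_mulM 1).mul hinverse
    rw [one_smul, ← multiplierOp_of_ne_one hz₁] at hmul
    refine hmul.congr (.of_forall fun t => ?_)
    rw [multiplier, Pi.mul_apply, Pi.inv_apply, one_mul, div_eq_mul_inv]

lemma norm_multiplierOp_le {θ : ℝ} (hθ : θ < Real.pi) (hz : |(1 - z).arg| ≤ θ) :
    ‖multiplierOp z‖ ≤ (Real.cos (θ / 2))⁻¹ := by
  have hθ₀ : 0 ≤ θ := (abs_nonneg _).trans hz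
  have hcos : 0 ≤ Real.cos (θ / 2) := Real.cos_nonneg_of_mem_Icc ⟨by linarith, by linarith⟩
  exact (isMultiplicationBy_multiplierOp (mem_cutPlane_of_abs_arg_le hθ hz)).opNorm_le
    (inv_nonneg.2 hcos)
    (ae_mMeas_pos.mono fun t ht => norm_multiplier_le_of_abs_arg_le hθ hz ht)

lemma differentiableOn_multiplierOp : DifferentiableOn ℂ multiplierOp openCutPlane := by
  have hdiff : DifferentiableOn ℂ
      (fun z : ℂ => (1 - mulM) * Ring.inverse (1 - z • mulM)) openCutPlane := by
    intro z hz
    obtain ⟨hz, hz₁⟩ := mem_openCutPlane_iff.1 hz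
    have hinverse : DifferentiableAt ℂ (fun z : ℂ => Ring.inverse (1 - z • mulM)) z :=
      DifferentiableAt.comp (g := Ring.inverse) z
        (differentiableAt_inverse (isUnit_one_sub_smul_mulM hz hz₁)) (by fun_prop)
    exact (hinverse.const_mul _).differentiableWithinAt
  exact hdiff.congr fun z hz => multiplierOp_of_ne_one (mem_openCutPlane_iff.1 hz).2

lemma tendsto_multiplierOp_apply {θ : ℝ} (hθ : θ < Real.pi) {z₀ : ℂ} (hz₀ : |(1 - z₀).arg| ≤ θ)
    (φ : L2m) :
    Tendsto (fun z => multiplierOp z φ) (𝓝[{z : ℂ | |(1 - z).arg| ≤ θ}] z₀)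
      (𝓝 (multiplierOp z₀ φ)) := by
  have hz₀' := mem_cutPlane_of_abs_arg_le hθ hz₀
  refine IsMultiplicationBy.tendsto_apply (g := multiplier) (g₀ := multiplier z₀)
    (C := (Real.cos (θ / 2))⁻¹ + (Real.cos (θ / 2))⁻¹) ?_ (isMultiplicationBy_multiplierOp hz₀')
    (.of_forall fun z => ?_) ?_ ?_ φ
  · filter_upwards [eventually_mem_nhdsWithin] with z hz
    exact isMultiplicationBy_multiplierOp (mem_cutPlane_of_abs_arg_le hθ hz)
  · exact ((measurable_multiplier z).sub (measurable_multiplier z₀)).aestronglyMeasurable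
  · filter_upwards [eventually_mem_nhdsWithin] with z hz
    filter_upwards [ae_mMeas_pos] with t ht
    exact norm_sub_le_of_le (norm_multiplier_le_of_abs_arg_le hθ hz ht)
      (norm_multiplier_le_of_abs_arg_le hθ hz₀ ht)
  · filter_upwards [ae_mMeas_pos] with t ht
    exact (continuousAt_multiplier hz₀' ht).tendsto.mono_left nhdsWithin_le_nhds

end MultiplierOp

section GeometricSeries

variable {z : ℂ}

lemma hasSum_pow_mul_cexp {t : ℝ} (hz : ‖z‖ ≤ 1) (ht : 0 < t) :
    HasSum (fun n : ℕ => z ^ (n + 1) * (Complex.exp (-(t * (n + 1 : ℕ))) * (Complex.exp t - 1)))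
      (z * multiplier z t) := by
  have hratio : ‖z * Complex.exp (-(t : ℂ))‖ < 1 := by
    rw [norm_mul, Complex.norm_exp, Complex.neg_re, Complex.ofReal_re]
    exact mul_lt_one_of_nonneg_of_lt_one_right hz (Real.exp_pos _).le
      (Real.exp_lt_one_iff.2 (neg_lt_zero.2 ht))
  have hexp : Complex.exp (-(t : ℂ)) * Complex.exp t = 1 := by
    rw [← Complex.exp_add, neg_add_cancel, Complex.exp_zero]
  have hsum := (hasSum_geometric_of_norm_lt_one hratio).mul_left
    (z * (Complex.exp (-(t : ℂ)) * (Complex.exp t - 1)))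
  rw [mul_sub, hexp, mul_one, mul_assoc, ← div_eq_mul_inv] at hsum
  refine hsum.congr_fun fun n => ?_
  have hpow : Complex.exp (-(t * (n + 1 : ℕ))) = Complex.exp (-(t : ℂ)) ^ (n + 1) := by
    rw [← Complex.exp_nat_mul]
    ring_nf
  rw [hpow, mul_pow]
  linear_combination (z ^ (n + 1) * Complex.exp (-(t : ℂ)) ^ n) * hexp

lemma hasSum_norm_cexp {t : ℝ} (ht : 0 < t) :
    HasSum (fun n : ℕ => ‖Complex.exp (-(t * (n + 1 : ℕ))) * (Complex.exp t - 1)‖) 1 := by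
  rw [← Complex.hasSum_ofReal, Complex.ofReal_one]
  have hsum := hasSum_pow_mul_cexp norm_one.le ht
  simp only [one_pow, one_mul, multiplier_one ht] at hsum
  refine hsum.congr_fun fun n => ?_
  have hpos := exp_sub_one_pos ht
  rw [show Complex.exp (-(t * (n + 1 : ℕ))) * (Complex.exp t - 1) =
    ((Real.exp (-(t * (n + 1 : ℕ))) * (Real.exp t - 1) : ℝ) : ℂ) by push_cast; rfl,
    Complex.norm_of_nonneg (by positivity)]

lemma hasSum_integral_multiplier {F : ℝ → ℂ} (hF : Integrable F mMeas) (hz : ‖z‖ ≤ 1) :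
    HasSum (fun n : ℕ => z ^ (n + 1) *
        ∫ t, Complex.exp (-(t * (n + 1 : ℕ))) * (Complex.exp t - 1) * F t ∂mMeas)
      (∫ t, z * multiplier z t * F t ∂mMeas) := by
  simp only [← integral_const_mul]
  refine hasSum_integral_of_dominated_convergence
    (fun n t => ‖Complex.exp (-(t * (n + 1 : ℕ))) * (Complex.exp t - 1)‖ * ‖F t‖)
    (fun n => ?_) (fun n => .of_forall fun t => ?_) ?_ ?_ ?_
  · have hmeas : AEStronglyMeasurable
        (fun t : ℝ => Complex.exp (-(t * (n + 1 : ℕ))) * (Complex.exp t - 1)) mMeas := by fun_prop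
    exact (hmeas.mul hF.aestronglyMeasurable).const_mul _
  · rw [norm_mul, norm_pow, norm_mul]
    exact mul_le_of_le_one_left (by positivity) (pow_le_one₀ (norm_nonneg z) hz)
  · filter_upwards [ae_mMeas_pos] with t ht
    exact (hasSum_norm_cexp ht).summable.mul_right _
  · refine hF.norm.congr ?_
    filter_upwards [ae_mMeas_pos] with t ht
    rw [tsum_mul_right, (hasSum_norm_cexp ht).tsum_eq, one_mul]
  · filter_upwards [ae_mMeas_pos] with t ht
    simpa only [mul_assoc] using (hasSum_pow_mul_cexp hz ht).mul_right (F t)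

end GeometricSeries

section Branches

lemma deriv_branch (n : ℕ) {x : ℝ} (hx : 0 < x) :
    deriv (branch (n + 1)) x = -(1 / (x + (n + 1 : ℕ)) ^ 2) := by
  have hne : x + (n + 1 : ℕ) ≠ 0 := by positivity
  have hderiv : HasDerivAt (branch (n + 1)) (-1 / (x + (n + 1 : ℕ)) ^ 2) x :=
    (((hasDerivAt_id x).add_const ((n + 1 : ℕ) : ℝ)).inv hne).congr_of_eventuallyEq
      (.of_forall fun y => one_div _)
  rw [hderiv.deriv, neg_div]

lemma passageTime_branch (n : ℕ) {x : ℝ} (hx : x ∈ Ioo (0 : ℝ) 1) :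
    passageTime (branch (n + 1) x) = n + 1 := by
  rw [passageTime, branch, one_div_one_div, Nat.floor_add_natCast hx.1.le,
    Nat.floor_eq_zero.2 hx.2, zero_add]

lemma ofUnit_branch (n : ℕ) {x : ℝ} (hx : x ∈ Ioo (0 : ℝ) 1) :
    ofUnit (branch (n + 1) x) (branch_mem n hx) = branchC n (ofUnit x hx) :=
  Subtype.ext (by simp [ofUnit, branchC, branch])

lemma isTransfer_of_hasSum {q : ℕ} {z : ℂ} {f g : HalfPlane → ℂ}
    (h : ∀ w : HalfPlane, HasSum (fun n : ℕ => (-1 : ℂ) ^ q * (z ^ (n + 1) *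
      (1 / ((w : ℂ) + (n + 1 : ℕ)) ^ 2) ^ (1 + q) * f (branchC n w))) (g w)) :
    IsTransfer q z f g := by
  refine ⟨fun x hx => (h (ofUnit x hx)).congr_fun fun n => ?_, h⟩
  rw [ofUnit_branch n hx, passageTime_branch n hx, deriv_branch n hx.1, abs_neg,
    abs_of_nonneg (by positivity)]
  simp [ofUnit]

end Branches

section TransferOperator

variable {z : ℂ}

/-- The operator `K_{z,q} = (-1)^q z (1 - M)(1 - zM)⁻¹ B_q` on `L₂(m)`. -/
def transferL2 (q : ℕ) (z : ℂ) : L2m →L[ℂ] L2m :=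
  ((-1 : ℂ) ^ q * z) • (multiplierOp z * besselOp q)

lemma transferL2_ae_eq (q : ℕ) (hz : z ∈ cutPlane) (φ : L2m) :
    ∀ᵐ t ∂mMeas, transferL2 q z φ t = (-1 : ℂ) ^ q * z * multiplier z t * besselOp q φ t := by
  filter_upwards [(isMultiplicationBy_multiplierOp hz).const_smul ((-1 : ℂ) ^ q * z)
    (besselOp q φ)] with t ht
  exact ht

lemma differentiableOn_transferL2 (q : ℕ) : DifferentiableOn ℂ (transferL2 q) openCutPlane :=
  (differentiableOn_id.const_mul _).smul (differentiableOn_multiplierOp.mul_const _)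

lemma continuousOn_transferL2 (q : ℕ) {θ : ℝ} (hθ : θ < Real.pi) :
    ContinuousOn (transferL2 q) {z : ℂ | |(1 - z).arg| ≤ θ} := by
  -- At `z = 1` the multipliers converge only strongly; composing with a nuclear operator makes
  -- the convergence uniform.
  refine (continuousOn_id.const_mul _).smul fun z hz => ?_
  exact (isTraceClass_besselOp q).tendsto_comp
    (eventually_mem_nhdsWithin.mono fun _ => norm_multiplierOp_le hθ)
    (tendsto_multiplierOp_apply hθ hz)

lemma isTraceClass_transferL2 (q : ℕ) (z : ℂ) : IsTraceClass (transferL2 q z) :=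
  ((isTraceClass_besselOp q).mul_left _).smul _

lemma laplaceEquiv_branchC (q n : ℕ) (φ : L2m) (w : HalfPlane) :
    (1 / ((w : ℂ) + (n + 1 : ℕ)) ^ 2) ^ (1 + q) * laplaceEquiv q φ (branchC n w) =
      ∫ t : ℝ, Complex.exp (-(t * (n + 1 : ℕ))) * (Complex.exp t - 1) *
        (Complex.exp (-(t * (w : ℂ))) * (t : ℂ) ^ q * besselOp q φ t) ∂mMeas := by
  have hre : 1 / 2 < ((w : ℂ) + (n + 1 : ℕ)).re := by
    rw [Complex.add_re, Complex.natCast_re]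
    push_cast
    linarith [w.2, n.cast_nonneg (α := ℝ)]
  rw [laplaceEquiv_apply, branchC, ← integral_laplaceKernel_mul_besselOp q φ hre]
  refine integral_congr_ae (.of_forall fun t => ?_)
  simp only [mul_add, neg_add, Complex.exp_add]
  ring

lemma hasSum_laplaceEquiv_transferL2 (q : ℕ) (hz : ‖z‖ ≤ 1) (φ : L2m) (w : HalfPlane) :
    HasSum (fun n : ℕ => (-1 : ℂ) ^ q * (z ^ (n + 1) *
      (1 / ((w : ℂ) + (n + 1 : ℕ)) ^ 2) ^ (1 + q) * laplaceEquiv q φ (branchC n w)))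
      (laplaceEquiv q (transferL2 q z φ) w) := by
  have hsum := (hasSum_integral_multiplier (integrable_kernel q w (besselOp q φ)) hz).mul_left
    ((-1 : ℂ) ^ q)
  have hvalue : laplaceEquiv q (transferL2 q z φ) w = (-1 : ℂ) ^ q * ∫ t : ℝ, z * multiplier z t *
      (Complex.exp (-(t * (w : ℂ))) * (t : ℂ) ^ q * besselOp q φ t) ∂mMeas := by
    rw [laplaceEquiv_apply, ← integral_const_mul]
    refine integral_congr_ae ?_
    filter_upwards [transferL2_ae_eq q (mem_cutPlane_of_norm_le_one hz) φ] with t ht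
    rw [ht]
    ring
  rw [hvalue]
  refine hsum.congr_fun fun n => ?_
  rw [← laplaceEquiv_branchC, mul_assoc (z ^ (n + 1))]

end TransferOperator

section LaplaceConj

/-- Conjugation by the unitary map `L_q`, which carries operators on `L₂(m)` to operators on
`H_{1,q}`. -/
def laplaceConj (q : ℕ) : (L2m →L[ℂ] L2m) ≃L[ℂ] (H1 q →L[ℂ] H1 q) :=
  (laplaceEquiv q).toContinuousLinearEquiv.arrowCongr (laplaceEquiv q).toContinuousLinearEquiv

lemma laplaceConj_apply_laplaceEquiv (q : ℕ) (T : L2m →L[ℂ] L2m) (φ : L2m) :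
    laplaceConj q T (laplaceEquiv q φ) = laplaceEquiv q (T φ) :=
  congrArg (fun ψ => laplaceEquiv q (T ψ)) ((laplaceEquiv q).symm_apply_apply φ)

lemma isTransfer_laplaceConj_transferL2 (q : ℕ) {z : ℂ} (hz : ‖z‖ ≤ 1) (f : H1 q) :
    IsTransfer q z f (laplaceConj q (transferL2 q z) f) := by
  obtain ⟨φ, rfl⟩ := (laplaceEquiv q).surjective f
  rw [laplaceConj_apply_laplaceEquiv]
  exact isTransfer_of_hasSum (hasSum_laplaceEquiv_transferL2 q hz φ)

end LaplaceConj

end FareyGauss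

end

theorem mainTheorem12 (q : ℕ) :
    ∃ (B : FareyGauss.L2m →L[ℂ] FareyGauss.L2m)
      (K : ℂ → FareyGauss.L2m →L[ℂ] FareyGauss.L2m)
      (Q : ℂ → FareyGauss.H1 q →L[ℂ] FareyGauss.H1 q),
      -- `B` is the integral operator with kernel `J_{2q+1}(2√(st))/√(st)`
      (∀ φ : FareyGauss.L2m, ∀ᵐ t ∂FareyGauss.mMeas,
        Integrable (fun s : ℝ => (FareyGauss.besselKernel q s t : ℂ) * φ s) FareyGauss.mMeas ∧
        B φ t = ∫ s : ℝ, (FareyGauss.besselKernel q s t : ℂ) * φ s ∂FareyGauss.mMeas) ∧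
      -- `K z = (-1)^q z (1 - M) (1 - z M)⁻¹ B`, operatorially and pointwise
      (∀ z ∈ FareyGauss.cutPlane, z ≠ 1 →
        IsUnit (1 - z • FareyGauss.mulM) ∧
        K z = ((-1 : ℂ) ^ q * z) •
          ((1 - FareyGauss.mulM) * Ring.inverse (1 - z • FareyGauss.mulM) * B)) ∧
      (∀ z ∈ FareyGauss.cutPlane, ∀ φ : FareyGauss.L2m, ∀ᵐ t ∂FareyGauss.mMeas,
        K z φ t = (-1 : ℂ) ^ q * z *
          ((1 - Complex.exp (-(t : ℂ))) / (1 - z * Complex.exp (-(t : ℂ)))) * B φ t) ∧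
      -- `Q z` is the transfer operator `Q_{z,q}` wherever its power series converges
      (∀ z : ℂ, ‖z‖ ≤ 1 → ∀ f : FareyGauss.H1 q, FareyGauss.IsTransfer q z f (Q z f)) ∧
      -- `z ↦ Q z` is the analytic continuation to the cut plane
      AnalyticOnNhd ℂ Q FareyGauss.openCutPlane ∧
      (∀ θ : ℝ, θ < Real.pi → ContinuousOn Q {z : ℂ | |(1 - z).arg| ≤ θ}) ∧
      -- conjugacy and trace class property
      (∀ z ∈ FareyGauss.cutPlane,
        (∀ φ : FareyGauss.L2m,
          Q z (FareyGauss.laplaceEquiv q φ) = FareyGauss.laplaceEquiv q (K z φ)) ∧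
        FareyGauss.IsTraceClass (Q z) ∧ FareyGauss.IsTraceClass (K z)) := by
  open FareyGauss in
  refine ⟨besselOp q, transferL2 q, fun z => laplaceConj q (transferL2 q z),
    besselOp_ae_eq_integral q, fun z hz hz₁ => ⟨isUnit_one_sub_smul_mulM hz hz₁, ?_⟩,
    fun z hz φ => transferL2_ae_eq q hz φ, fun z hz f => isTransfer_laplaceConj_transferL2 q hz f,
    ?analytic, fun θ hθ => ?continuous, fun z _ => ⟨laplaceConj_apply_laplaceEquiv q _,
      (isTraceClass_transferL2 q z).conj (laplaceEquiv q), isTraceClass_transferL2 q z⟩⟩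
  · rw [transferL2, multiplierOp_of_ne_one hz₁]
  case analytic =>
    exact ((laplaceConj q).differentiable.comp_differentiableOn
      (differentiableOn_transferL2 q)).analyticOnNhd isOpen_openCutPlane
  case continuous =>
    exact (laplaceConj q).continuous.comp_continuousOn (continuousOn_transferL2 q hθ)
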